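/- For each sample size $n\ge 1$ let $$X_t=f_t+\varepsilon_t,\qquad f_t=f_{0}+\sum_{j=1}^{q_n} d_j\,\mathbb I_{\{t\ge k_j+1\}},\qquad 1\le t\le n,$$ with change points $0=k_0<k_1<\dots<k_{q_n}<k_{q_n+1}=n$ and jumps $d_j\neq 0$ (all of $f_0,q_n,k_j,d_j$ are deterministic and may depend on $n$; $q_n=0$ is allowed). Put $\delta_j=\min(k_j-k_{j-1},k_{j+1}-k_j)$ and $D_n=\min_{1\le j\le q_n}d_j^2\delta_j$ (with $D_n=\infty$ if $q_n=0$), and suppose $\max_j|d_j|=O(1)$ and $\min_j\delta_j\to\infty$. Let $\omega_n,\omega_n^{(1)},\omega_n^{(2)},\rho_n,\xi_n$ be real sequences with $\xi_n>0$. Assume: 1. *Errors.* $(\varepsilon_t)_{t\ge1}$ is ergodic, $\mathsf E\,\varepsilon_t=0$ and $0<c\le \mathrm{Var}(\varepsilon_t)\le C<\infty$ for all $t$. Here ergodic means that either $(\varepsilon_t)$ is strictly stationary and ergodic under the shift, or (stationary or not) for all $m$ and all measurable $g:\mathbb R^m\to\mathbb R$ of at most quadratic growth $\frac1n\sum_{t=1}^n\{g(\varepsilon_t,\dots,\varepsilon_{t+m-1})-\mathsf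 E\,g(\varepsilon_t,\dots,\varepsilon_{t+m-1})\}\to0$ in probability. Moreover $\sqrt{\log n}=O(\omega_n)$ and $\mathsf P(\mathcal M_n^{(11)})\to1$, where $$\mathcal M_n^{(11)}=\Big\{\max_{0\le s<e\le n}\tfrac1{\sqrt{e-s}}\Big|\sum_{t=s+1}^e\varepsilon_t\Big|\le\omega_n\Big\},$$ and for any sequences $a_n,b_n$ with $1\le a_n,b_n\le D_n$ for all large $n$, $\mathsf P(\mathcal M_n^{(12)}\cap\mathcal M_n^{(13)})\to1$, where $\mathcal M_n^{(12)}=\mathcal M_n^{(12)}(a_n)$ is the event that for all $1\le j\le q_n$ $$\max_{d_j^{-2}a_n\le\ell\le k_j-k_{j-1}}\tfrac{\sqrt{d_j^{-2}a_n}}{\ell}\Big|\sum_{t=k_j-\ell+1}^{k_j}\varepsilon_t\Big|\le\omega_n^{(1)},\qquad \max_{d_j^{-2}a_n\le\ell\le k_{j+1}-k_j}\tfrac{\sqrt{d_j^{-2}a_n}}{\ell}\Big|\sum_{t=k_j+1}^{k_j+\ell}\varepsilon_t\Big|\le\omega_n^{(1)},$$ and $\mathcal M_n^{(13)}=\mathcal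 M_n^{(13)}(b_n)$ is the event that for all $1\le j\le q_n$ $$\max_{1\le\ell\le d_j^{-2}b_n}\tfrac{1}{\sqrt{d_j^{-2}b_n}}\Big|\sum_{t=k_j-\ell+1}^{k_j}\varepsilon_t\Big|\le\omega_n^{(2)},\qquad \max_{1\le\ell\le d_j^{-2}b_n}\tfrac{1}{\sqrt{d_j^{-2}b_n}}\Big|\sum_{t=k_j+1}^{k_j+\ell}\varepsilon_t\Big|\le\omega_n^{(2)}.$$ 2. *Size of changes.* $D_n^{-1}\omega_n^2\to0$. 3. *Penalty.* $\xi_n/D_n\to0$ and $\omega_n^2/\xi_n\to0$. 4. *Candidates.* $\mathcal K=\mathcal K_n\subset\{1,\dots,n-1\}$ is a random set with $n^{-1}\omega_n^2|\mathcal K_n|\to0$ in probability and $\mathsf P(\mathcal M_n^{(2)})\to1$, where $\mathcal M_n^{(2)}=\{\max_{1\le j\le q_n}\min_{k\in\mathcal K}d_j^2|k-k_j|\le\rho_n\}$, and $\max(\omega_n^{(1)},\omega_n^{(2)})^2=O(\rho_n)$, $\rho_n=O(\omega_n^2)$. For $\mathcal A=\{a_1<\dots<a_m\}\subset\mathcal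 K$, $a_0=0$, $a_{m+1}=n$, let $\mathrm{RSS}(\mathcal A)=\sum_{i=0}^m\sum_{t=a_i+1}^{a_{i+1}}(X_t-\bar X_{(a_i+1):a_{i+1}})^2$, where $\bar X_{(u+1):v}$ is the mean of $X_{u+1},\dots,X_v$, and $\mathrm{SC}(\mathcal A)=\frac n2\log\{\mathrm{RSS}(\mathcal A)/n\}+|\mathcal A|\,\xi_n$. Let $\mathcal F$ be the family of all $\mathcal A\subset\mathcal K$ such that adding further candidates to $\mathcal A$ monotonically increases SC, i.e. $\mathrm{SC}(\mathcal B)\le\mathrm{SC}(\mathcal B')$ whenever $\mathcal A\subset\mathcal B\subset\mathcal B'\subset\mathcal K$ (criterion C1), let $m^*=\min_{\mathcal A\in\mathcal F}|\mathcal A|$, and let $\widehat{\mathcal A}=\{\hat k_1<\dots<\hat k_{\hat q_n}\}$ be a minimiser of SC over $\{\mathcal A\in\mathcal F:|\mathcal A|=m^*\}$, ties being broken arbitrarily (criterion C2$'$). Let $\nu_n\to\infty$ at any rate, however slow, with $\rho_n\nu_n\ge1$ for all large $n$ (automatic if $\rho_n$ is bounded away from $0$). Then, for any sequences $a_n,b_n$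 with $1\le a_n,b_n\le D_n$ for all large $n$ and $\mathcal M_n=\mathcal M_n^{(11)}\cap\mathcal M_n^{(12)}\cap\mathcal M_n^{(13)}\cap\mathcal M_n^{(2)}$, $$\mathsf P\Big\{\hat q_n=q_n;\ \max_{1\le j\le q_n}d_j^2\,\big|\hat k_j\,\mathbb I_{\{j\le\hat q_n\}}-k_j\big|\le\rho_n\nu_n\Big\}\ \ge\ \mathsf P(\mathcal M_n)+o(1)\ \to\ 1 .$$ -/

import Mathlib

open MeasureTheory ProbabilityTheory Filter Topology Asymptotics

noncomputable section

namespace ChangePoint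

/-! ### The signal -/

/-- A piecewise constant signal: its initial level `base`, the number `q` of change points, their
locations `k 1 < ... < k q` (with `k 0 = 0` and `k (q + 1) = n`) and their jumps `d 1, ..., d q`.
Values of `k` outside `0, ..., q + 1` and of `d` outside `1, ..., q` are irrelevant. -/
structure Signal where
  base : ℝ
  q : ℕ
  k : ℕ → ℕ
  d : ℕ → ℝ

namespace Signal

/-- `S` is a signal on the time points `1, ..., n`. -/
structure IsValid (S : Signal) (n : ℕ) : Prop where
  k_zero : S.k 0 = 0
  k_last : S.k (S.q + 1) = n
  k_lt : ∀ j ≤ S.q, S.k j < S.k (j + 1)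
  d_ne_zero : ∀ j ∈ Finset.Icc 1 S.q, S.d j ≠ 0

/-- `f_t = f_0 + ∑_{j = 1}^{q} d_j 𝟙{t ≥ k_j + 1}`. -/
def mean (S : Signal) (t : ℕ) : ℝ :=
  S.base + ∑ j ∈ Finset.Icc 1 S.q, if S.k j + 1 ≤ t then S.d j else 0

/-- The distance `δ_j` of the `j`-th change point to its neighbours (for `1 ≤ j ≤ q`). -/
def gap (S : Signal) (j : ℕ) : ℕ :=
  min (S.k j - S.k (j - 1)) (S.k (j + 1) - S.k j)

/-- `D_n = min_{1 ≤ j ≤ q} d_j² δ_j`; the minimum over the empty set is `∞`. -/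
def strength (S : Signal) : ENNReal :=
  ⨅ j ∈ Finset.Icc 1 S.q, ENNReal.ofReal (S.d j ^ 2 * (S.gap j : ℝ))

end Signal

/-! ### Schwarz criterion and pruning -/

/-- The average of `X_t` over `u < t ≤ v`. -/
def segMean (X : ℕ → ℝ) (u v : ℕ) : ℝ :=
  (∑ t ∈ Finset.Ioc u v, X t) / ((v : ℝ) - (u : ℝ))

/-- The smallest element of `A ∪ {n}` that is larger than `u`. -/
def nextPt (n : ℕ) (A : Finset ℕ) (u : ℕ) : ℕ :=
  sInf {v : ℕ | (v ∈ A ∨ v = n) ∧ u < v}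

/-- Residual sum of squares of the sample `X_1, ..., X_n` for the segmentation of `(0, n]` with
cut points `A ⊆ {1, ..., n - 1}`: the segments are `(u, nextPt n A u]` with `u ∈ A ∪ {0}`. -/
def RSS (n : ℕ) (X : ℕ → ℝ) (A : Finset ℕ) : ℝ :=
  ∑ u ∈ insert 0 A, ∑ t ∈ Finset.Ioc u (nextPt n A u), (X t - segMean X u (nextPt n A u)) ^ 2

/-- The Schwarz criterion with penalty `ξ`. -/
def SC (n : ℕ) (ξ : ℝ) (X : ℕ → ℝ) (A : Finset ℕ) : ℝ :=
  (n : ℝ) / 2 * Real.log (RSS n X A / n) + (A.card : ℝ) * ξ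

/-- Criterion (C1): the family of all `A ⊆ D` such that adding further candidates from `D` to `A`
monotonically increases the Schwarz criterion. -/
def admissible (n : ℕ) (ξ : ℝ) (X : ℕ → ℝ) (D : Finset ℕ) : Set (Finset ℕ) :=
  {A | A ⊆ D ∧ ∀ B B' : Finset ℕ, A ⊆ B → B ⊆ B' → B' ⊆ D → SC n ξ X B ≤ SC n ξ X B'}

/-- Criteria (C1) and (C2'): `A` minimises the Schwarz criterion among the sets of (C1) that have
the minimal cardinality. Ties may be broken in any way. -/
def IsPruned (n : ℕ) (ξ : ℝ) (X : ℕ → ℝ) (D A : Finset ℕ) : Prop :=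
  A ∈ admissible n ξ X D ∧
    (∀ B ∈ admissible n ξ X D, A.card ≤ B.card) ∧
    ∀ B ∈ admissible n ξ X D, B.card = A.card → SC n ξ X A ≤ SC n ξ X B

/-- The `j`-th smallest element of `K` (`j ≥ 1`), and `0` if `K` has fewer than `j` elements,
i.e. `k̂_j 𝟙{j ≤ q̂}`. -/
def estimate (K : Finset ℕ) (j : ℕ) : ℕ := Nat.nth (fun x => x ∈ K) (j - 1)

/-! ### Errors -/

variable {Ω : Type*} [MeasurableSpace Ω]

/-- The classical notion: `ε_1, ε_2, ...` is strictly stationary and the shift on the space of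
its paths is ergodic. -/
def IsStationaryErgodic (P : Measure Ω) (ε : ℕ → Ω → ℝ) : Prop :=
  Ergodic (fun (x : ℕ → ℝ) (i : ℕ) => x (i + 1)) (P.map (fun (x : Ω) (i : ℕ) => ε (i + 1) x))

/-- Ergodicity without stationarity: for every observable of finitely many consecutive errors of
at most quadratic growth, the difference of time average and ensemble average tends to `0` in
probability. (For a stationary square-integrable sequence this is equivalent to the classical
notion, by the ergodic theorem.) -/
def IsMeanErgodic (P : Measure Ω) (ε : ℕ → Ω → ℝ) : Prop :=
  ∀ (m : ℕ) (g : (Fin m → ℝ) → ℝ), Measurable g →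
    (∃ K : ℝ, ∀ x, |g x| ≤ K * (1 + ‖x‖ ^ 2)) →
    TendstoInMeasure P
      (fun (n : ℕ) (x : Ω) => (∑ t ∈ Finset.Icc 1 n,
        (g (fun i => ε (t + i) x) - ∫ y, g (fun i => ε (t + i) y) ∂P)) / (n : ℝ))
      atTop (fun _ => (0 : ℝ))

/-- The errors `ε_1, ε_2, ...` are ergodic, stationary or not. -/
def IsErgodicSequence (P : Measure Ω) (ε : ℕ → Ω → ℝ) : Prop :=
  IsStationaryErgodic P ε ∨ IsMeanErgodic P ε

/-- `max_{0 ≤ s < e ≤ n} (e - s)^{-1/2} |∑_{t = s + 1}^{e} ε_t| ≤ w`. -/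
def eventM11 (ε : ℕ → Ω → ℝ) (n : ℕ) (w : ℝ) : Set Ω :=
  {x | ∀ s e : ℕ, s < e → e ≤ n →
    1 / √((e : ℝ) - (s : ℝ)) * |∑ t ∈ Finset.Ioc s e, ε t x| ≤ w}

/-- Weighted sums of errors at distance at least `d_j⁻² a` to the left and right of every change
point. -/
def eventM12 (ε : ℕ → Ω → ℝ) (S : Signal) (a w : ℝ) : Set Ω :=
  {x | ∀ j ∈ Finset.Icc 1 S.q,
    (∀ l : ℕ, a / S.d j ^ 2 ≤ (l : ℝ) → l ≤ S.k j - S.k (j - 1) →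
      √(a / S.d j ^ 2) / (l : ℝ) * |∑ t ∈ Finset.Ioc (S.k j - l) (S.k j), ε t x| ≤ w) ∧
    (∀ l : ℕ, a / S.d j ^ 2 ≤ (l : ℝ) → l ≤ S.k (j + 1) - S.k j →
      √(a / S.d j ^ 2) / (l : ℝ) * |∑ t ∈ Finset.Ioc (S.k j) (S.k j + l), ε t x| ≤ w)}

/-- Sums of errors at distance at most `d_j⁻² b` to the left and right of every change point. -/
def eventM13 (ε : ℕ → Ω → ℝ) (S : Signal) (b w : ℝ) : Set Ω :=
  {x | ∀ j ∈ Finset.Icc 1 S.q, ∀ l : ℕ, 1 ≤ l → (l : ℝ) ≤ b / S.d j ^ 2 →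
    1 / √(b / S.d j ^ 2) * |∑ t ∈ Finset.Ioc (S.k j - l) (S.k j), ε t x| ≤ w ∧
    1 / √(b / S.d j ^ 2) * |∑ t ∈ Finset.Ioc (S.k j) (S.k j + l), ε t x| ≤ w}

/-- Every change point has a candidate in its `d_j⁻² ρ`-environment. -/
def eventM2 (S : Signal) (C : Ω → Finset ℕ) (ρ : ℝ) : Set Ω :=
  {x | ∀ j ∈ Finset.Icc 1 S.q, ∃ c ∈ C x, S.d j ^ 2 * |(c : ℝ) - (S.k j : ℝ)| ≤ ρ}

/-- `a` is a sequence with `1 ≤ a_n ≤ D_n` (for all large `n`, as `D_n` may be smaller than `1`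
for small `n`). -/
def IsScale (S : ℕ → Signal) (a : ℕ → ℝ) : Prop :=
  ∀ᶠ n in atTop, 1 ≤ a n ∧ ENNReal.ofReal (a n) ≤ (S n).strength

/-! ### Assumptions -/

/-- Standing assumptions on the signals: bounded jumps, diverging distances. -/
structure SignalAssumption (S : ℕ → Signal) : Prop where
  valid : ∀ n : ℕ, 1 ≤ n → (S n).IsValid n
  jump_bounded : ∃ B : ℝ, ∀ n : ℕ, 1 ≤ n → ∀ j ∈ Finset.Icc 1 (S n).q, |(S n).d j| ≤ B
  gap_diverges : ∀ m : ℕ, ∀ᶠ n in atTop, ∀ j ∈ Finset.Icc 1 (S n).q, m ≤ (S n).gap j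

/-- Assumption on the error distribution, with rates `w = ω_n`, `w₁ = ω_n^{(1)}`,
`w₂ = ω_n^{(2)}`. -/
structure ErrorAssumption (P : Measure Ω) (ε : ℕ → Ω → ℝ) (S : ℕ → Signal)
    (w w₁ w₂ : ℕ → ℝ) : Prop where
  measurable : ∀ t, Measurable (ε t)
  ergodic : IsErgodicSequence P ε
  memLp : ∀ t, 1 ≤ t → MemLp (ε t) 2 P
  centred : ∀ t, 1 ≤ t → ∫ x, ε t x ∂P = 0
  variance_bounds : ∃ c₀ c₁ : ℝ, 0 < c₀ ∧
    ∀ t, 1 ≤ t → c₀ ≤ variance (ε t) P ∧ variance (ε t) P ≤ c₁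
  rate_lower : (fun n : ℕ => √(Real.log n)) =O[atTop] w
  prob_M11 : Tendsto (fun n => P.real (eventM11 ε n (w n))) atTop (𝓝 1)
  prob_M12_M13 : ∀ a b : ℕ → ℝ, IsScale S a → IsScale S b →
    Tendsto (fun n => P.real (eventM12 ε (S n) (a n) (w₁ n) ∩ eventM13 ε (S n) (b n) (w₂ n)))
      atTop (𝓝 1)

/-- Multiscale lower bound on the size of changes: `D_n⁻¹ ω_n² → 0`. -/
def SizeAssumption (S : ℕ → Signal) (w : ℕ → ℝ) : Prop :=
  Tendsto (fun n => ENNReal.ofReal (w n ^ 2) / (S n).strength) atTop (𝓝 0)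

/-- The penalty `ξ_n` satisfies `ξ_n / D_n → 0` and `ω_n² / ξ_n → 0`. -/
structure PenaltyAssumption (S : ℕ → Signal) (w ξ : ℕ → ℝ) : Prop where
  pos : ∀ n, 0 < ξ n
  upper : Tendsto (fun n => ENNReal.ofReal (ξ n) / (S n).strength) atTop (𝓝 0)
  lower : Tendsto (fun n => w n ^ 2 / ξ n) atTop (𝓝 0)

/-- Assumption on the candidate sets `C n` (random subsets of `{1, ..., n - 1}`) with
precision `ρ`. -/
structure CandidateAssumption (P : Measure Ω) (S : ℕ → Signal) (C : ℕ → Ω → Finset ℕ)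
    (w w₁ w₂ ρ : ℕ → ℝ) : Prop where
  subset : ∀ n x, C n x ⊆ Finset.Ioo 0 n
  prob_M2 : Tendsto (fun n => P.real (eventM2 (S n) (C n) (ρ n))) atTop (𝓝 1)
  precision_lower : (fun n => (max (w₁ n) (w₂ n)) ^ 2) =O[atTop] ρ
  precision_upper : ρ =O[atTop] (fun n => w n ^ 2)
  card_small : TendstoInMeasure P
    (fun (n : ℕ) (x : Ω) => w n ^ 2 * ((C n x).card : ℝ) / (n : ℝ)) atTop (fun _ => (0 : ℝ))

/-- The event `M_n`. -/
def eventM (ε : ℕ → Ω → ℝ) (S : Signal) (C : Ω → Finset ℕ) (n : ℕ) (w w₁ w₂ ρ a b : ℝ) : Set Ω :=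
  eventM11 ε n w ∩ eventM12 ε S a w₁ ∩ eventM13 ε S b w₂ ∩ eventM2 S C ρ

/-- The estimator `K` has the correct number of elements, and each of them is close to the
corresponding change point: `d_j² |k̂_j 𝟙{j ≤ q̂} - k_j| ≤ r` for `1 ≤ j ≤ q`. -/
def eventConsistent (S : Signal) (K : Ω → Finset ℕ) (r : ℝ) : Set Ω :=
  {x | (K x).card = S.q ∧ ∀ j ∈ Finset.Icc 1 S.q,
    S.d j ^ 2 * |(estimate (K x) j : ℝ) - (S.k j : ℝ)| ≤ r}

end ChangePoint

end

noncomputable section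

namespace ChangePoint

/-! ### Segments -/

/-! The proof separates a deterministic statement at a fixed sample size (`Regular.consistent`) from
the probability that its hypotheses `Regular` hold.

Deterministic part. Cutting a segment `(u, v]` at `c` lowers the residual sum of squares by exactly
the squared contrast `z` (`segSq_split`). For the cut sets that matter, RSS is bounded above and
below by multiples of `n`, so the cut changes SC by `ξ` minus a quantity comparable to `z`. Two
precisions are compared, both measured as `d_j² · distance`: a fine one `r`, small against `ξ`, and
a rough one `τ`, a large multiple of `ξ` that is still far below the strength `G` of the signal. If
every change point has a cut point within `r`, the signal is nearly constant on each segment in the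
sense of `ℓ²`, so `z = O(r + w²)` is beaten by the penalty: such sets satisfy (C1)
(`mem_admissible`). If some change point is missed by more than `τ`, then after candidates near all
other change points have been added, a candidate near the missed one has `z ≥ τ / 12` and lowers SC,
which contradicts (C1) (`detects_of_mem_admissible`). As points within `τ` of different change
points are distinct, the minimal cardinality in (C1) is exactly `q`.

The precision then improves from `τ` to `r`. Among sets of `q` points the order by SC is the order
by RSS, and a point farther than `r` from its change point can be exchanged for a candidate within
`ρ` so that RSS strictly decreases (`segSq_swap_lt`, `exists_RSS_lt`): the systematic gain is linear
in the distance moved and dominates the noise sums controlled by the local events. Hence an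
RSS-minimiser among the roughly correct sets is finely correct, so it satisfies (C1) and competes in
(C2').

Probabilistic part. The local events are used with both scales equal to `r = precision ρ ν ξ`, which
satisfies `1 ≤ r ≤ ρν`, `ρ = o(r)` and `r = o(ξ)` (`eventually_rateBounds`). The noise energy is at
least `κ n` with high probability by ergodicity (`exists_sum_sq_ge`), and at most `M n` by Markov's
inequality, where `M` depends on the probability aimed at. The inequality with `P(M_n) + o(1)` for
other scales `a`, `b` follows because both probabilities tend to 1. -/

/-- `(u, v]` is a segment of `(0, n]` cut at the points of `A`. -/
structure IsSegment (n : ℕ) (A : Finset ℕ) (u v : ℕ) : Prop where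
  left : u ∈ insert 0 A
  right : v ∈ A ∨ v = n
  lt : u < v
  le : v ≤ n
  gap : ∀ x ∈ A, x ≤ u ∨ v ≤ x

theorem IsSegment.nextPt_eq {n : ℕ} {A : Finset ℕ} {u v : ℕ} (h : IsSegment n A u v) :
    nextPt n A u = v := by
  have hmem : v ∈ {v : ℕ | (v ∈ A ∨ v = n) ∧ u < v} := ⟨h.right, h.lt⟩
  refine le_antisymm (Nat.sInf_le hmem) (le_csInf ⟨v, hmem⟩ ?_)
  rintro y ⟨hy | hy, huy⟩
  · rcases h.gap y hy with h1 | h1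
    · omega
    · exact h1
  · exact hy ▸ h.le

theorem nextPt_spec {n : ℕ} {A : Finset ℕ} {u : ℕ} (hu : u < n) :
    (nextPt n A u ∈ A ∨ nextPt n A u = n) ∧ u < nextPt n A u :=
  Nat.sInf_mem (s := {v : ℕ | (v ∈ A ∨ v = n) ∧ u < v}) ⟨n, Or.inr rfl, hu⟩

theorem nextPt_le {n : ℕ} {A : Finset ℕ} {u x : ℕ} (hx : x ∈ A ∨ x = n) (hu : u < x) :
    nextPt n A u ≤ x :=
  Nat.sInf_le ⟨hx, hu⟩

theorem isSegment_nextPt {n : ℕ} {A : Finset ℕ} (hA : A ⊆ Finset.Ioo 0 n) (hn : 0 < n) {u : ℕ}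
    (hu : u ∈ insert 0 A) : IsSegment n A u (nextPt n A u) := by
  have hun : u < n := by
    rcases Finset.mem_insert.1 hu with h | h
    · omega
    · exact (Finset.mem_Ioo.1 (hA h)).2
  refine ⟨hu, (nextPt_spec hun).1, (nextPt_spec hun).2, nextPt_le (Or.inr rfl) hun, ?_⟩
  intro x hx
  rcases Nat.lt_or_ge u x with h | h
  · exact Or.inr (nextPt_le (Or.inl hx) h)
  · exact Or.inl h

theorem exists_isSegment {n : ℕ} {A : Finset ℕ} {c : ℕ} (hc : c ∉ A)
    (h0 : 0 < c) (hn : c < n) : ∃ u v, IsSegment n A u v ∧ u < c ∧ c < v := by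
  have hne : ((insert 0 A).filter (· < c)).Nonempty := ⟨0, by simp [h0]⟩
  set u := ((insert 0 A).filter (· < c)).max' hne with hu
  have humem := Finset.mem_filter.1 (Finset.max'_mem _ hne)
  rw [← hu] at humem
  have hsp := nextPt_spec (A := A) hn
  refine ⟨u, nextPt n A c, ⟨humem.1, hsp.1, humem.2.trans hsp.2, nextPt_le (Or.inr rfl) hn, ?_⟩,
    humem.2, hsp.2⟩
  intro x hx
  rcases lt_trichotomy x c with h | h | h
  · left
    exact Finset.le_max' _ _ (by simp [hx, h])
  · exact absurd (h ▸ hx) hc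
  · exact Or.inr (nextPt_le (Or.inl hx) h)

/-- The sum of `Φ u v` over all segments `(u, v]` cut at the points of `A`. -/
def segSum (n : ℕ) (A : Finset ℕ) (Φ : ℕ → ℕ → ℝ) : ℝ :=
  ∑ u ∈ insert 0 A, Φ u (nextPt n A u)

theorem segSum_empty {n : ℕ} (hn : 0 < n) (Φ : ℕ → ℕ → ℝ) : segSum n ∅ Φ = Φ 0 n := by
  have h : nextPt n ∅ 0 = n := IsSegment.nextPt_eq ⟨by simp, Or.inr rfl, hn, le_rfl, by simp⟩
  simp [segSum, h]

/-- Only the successor of `u` changes, and `c` inherits the old successor `v`. Every effect of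
adding or exchanging a cut point is computed from this identity. -/
theorem segSum_insert {n : ℕ} {A : Finset ℕ} (hA : A ⊆ Finset.Ioo 0 n) {u v c : ℕ}
    (h : IsSegment n A u v) (huc : u < c) (hcv : c < v) (Φ : ℕ → ℕ → ℝ) :
    segSum n (insert c A) Φ = segSum n A Φ - Φ u v + Φ u c + Φ c v := by
  have hn : 0 < n := lt_of_lt_of_le (by omega) h.le
  have hcA : c ∉ insert 0 A := by
    intro hc
    rcases Finset.mem_insert.1 hc with h1 | h1
    · omega
    · rcases h.gap c h1 with h2 | h2 <;> omega
  have hcs : nextPt n (insert c A) c = v := by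
    refine IsSegment.nextPt_eq ⟨by simp, ?_, hcv, h.le, ?_⟩
    · rcases h.right with h1 | h1
      · exact Or.inl (Finset.mem_insert_of_mem h1)
      · exact Or.inr h1
    · intro x hx
      rcases Finset.mem_insert.1 hx with rfl | hx
      · exact Or.inl le_rfl
      · rcases h.gap x hx with h2 | h2
        · left; omega
        · exact Or.inr h2
  have hus : nextPt n (insert c A) u = c := by
    refine IsSegment.nextPt_eq ⟨?_, by simp, huc, by have := h.le; omega, ?_⟩
    · rcases Finset.mem_insert.1 h.left with h1 | h1
      · simp [h1]
      · simp [h1]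
    · intro x hx
      rcases Finset.mem_insert.1 hx with rfl | hx
      · exact Or.inr le_rfl
      · rcases h.gap x hx with h2 | h2
        · exact Or.inl h2
        · right; omega
  have hrest : ∀ x ∈ (insert 0 A).erase u, Φ x (nextPt n (insert c A) x) = Φ x (nextPt n A x) := by
    intro x hx
    obtain ⟨hxu, hx⟩ := Finset.mem_erase.1 hx
    have hs := isSegment_nextPt hA hn hx
    congr 1
    refine IsSegment.nextPt_eq ⟨?_, ?_, hs.lt, hs.le, ?_⟩
    · rw [Finset.insert_comm]; exact Finset.mem_insert_of_mem hx
    · rcases hs.right with h1 | h1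
      · exact Or.inl (Finset.mem_insert_of_mem h1)
      · exact Or.inr h1
    · intro y hy
      rcases Finset.mem_insert.1 hy with rfl | hy
      · rcases Nat.lt_or_ge x u with h1 | h1
        · right
          have : u ∈ A := by
            rcases Finset.mem_insert.1 h.left with h2 | h2
            · omega
            · exact h2
          exact (nextPt_le (Or.inl this) h1).trans huc.le
        · left
          have hxA : x ∈ A := by
            rcases Finset.mem_insert.1 hx with h2 | h2
            · omega
            · exact h2
          rcases h.gap x hxA with h2 | h2 <;> omega
      · exact hs.gap y hy
  unfold segSum
  rw [Finset.insert_comm, Finset.sum_insert hcA, ← Finset.add_sum_erase _ _ h.left,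
    ← Finset.add_sum_erase _ _ h.left, Finset.sum_congr rfl hrest, hcs, hus, h.nextPt_eq]
  ring

theorem segSum_additive {n : ℕ} (hn : 0 < n) {A : Finset ℕ} (hA : A ⊆ Finset.Ioo 0 n)
    {Φ : ℕ → ℕ → ℝ} (hΦ : ∀ u c v, u < c → c < v → Φ u v = Φ u c + Φ c v) :
    segSum n A Φ = Φ 0 n := by
  induction A using Finset.induction_on with
  | empty => exact segSum_empty hn Φ
  | insert c A hc ih =>
    have hA' : A ⊆ Finset.Ioo 0 n := fun x hx => hA (Finset.mem_insert_of_mem hx)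
    obtain ⟨h0, h1⟩ := Finset.mem_Ioo.1 (hA (Finset.mem_insert_self c A))
    obtain ⟨u, v, hs, huc, hcv⟩ := exists_isSegment hc h0 h1
    rw [segSum_insert hA' hs huc hcv, ih hA', hΦ u c v huc hcv]
    ring

theorem segSum_sum_Ioc {n : ℕ} (hn : 0 < n) {A : Finset ℕ} (hA : A ⊆ Finset.Ioo 0 n)
    (g : ℕ → ℝ) : segSum n A (fun u v => ∑ t ∈ Finset.Ioc u v, g t) = ∑ t ∈ Finset.Ioc 0 n, g t :=
  segSum_additive hn hA fun _ _ _ h1 h2 => (Finset.sum_Ioc_consecutive g h1.le h2.le).symm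

theorem segSum_mono {n : ℕ} (hn : 0 < n) {A : Finset ℕ} (hA : A ⊆ Finset.Ioo 0 n)
    {Φ Ψ : ℕ → ℕ → ℝ} (h : ∀ u v, IsSegment n A u v → Φ u v ≤ Ψ u v) :
    segSum n A Φ ≤ segSum n A Ψ :=
  Finset.sum_le_sum fun _ hu => h _ _ (isSegment_nextPt hA hn hu)

theorem segSum_const_le (n : ℕ) (A : Finset ℕ) {K : ℝ} (hK : 0 ≤ K) :
    segSum n A (fun _ _ => K) ≤ ((A.card : ℝ) + 1) * K := by
  unfold segSum
  rw [Finset.sum_const, nsmul_eq_mul]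
  gcongr
  exact_mod_cast Finset.card_insert_le 0 A

theorem segSum_add (n : ℕ) (A : Finset ℕ) (Φ Ψ : ℕ → ℕ → ℝ) :
    segSum n A (fun u v => Φ u v + Ψ u v) = segSum n A Φ + segSum n A Ψ :=
  Finset.sum_add_distrib

/-! ### Residuals and contrasts -/

/-- The residual sum of squares over `(u, v]`. -/
def segSq (Y : ℕ → ℝ) (u v : ℕ) : ℝ := ∑ t ∈ Finset.Ioc u v, (Y t - segMean Y u v) ^ 2

theorem RSS_eq_segSum (n : ℕ) (X : ℕ → ℝ) (A : Finset ℕ) : RSS n X A = segSum n A (segSq X) := rfl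

/-- The weighted difference of the averages over `(c, v]` and `(u, c]`. -/
def contrast (Y : ℕ → ℝ) (u c v : ℕ) : ℝ :=
  √(((c : ℝ) - u) * ((v : ℝ) - c) / ((v : ℝ) - u)) * (segMean Y c v - segMean Y u c)

theorem sum_eq_segMean (Y : ℕ → ℝ) {u v : ℕ} (h : u < v) :
    ∑ t ∈ Finset.Ioc u v, Y t = ((v : ℝ) - u) * segMean Y u v := by
  have : (u : ℝ) < v := by exact_mod_cast h
  unfold segMean
  field_simp [sub_ne_zero.2 this.ne']

theorem sum_Ioc_sq_sub (Y : ℕ → ℝ) {u v : ℕ} (h : u ≤ v) (L : ℝ) :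
    ∑ t ∈ Finset.Ioc u v, (Y t - L) ^ 2 =
      ∑ t ∈ Finset.Ioc u v, Y t ^ 2 - 2 * L * ∑ t ∈ Finset.Ioc u v, Y t +
        ((v : ℝ) - u) * L ^ 2 := by
  simp only [sub_sq, Finset.sum_add_distrib, Finset.sum_sub_distrib, Finset.sum_const,
    Nat.card_Ioc, nsmul_eq_mul, Nat.cast_sub h, Finset.mul_sum]
  congr 2
  exact Finset.sum_congr rfl fun t _ => by ring

theorem sum_Ioc_sq_sub_eq (Y : ℕ → ℝ) {u v : ℕ} (h : u < v) (L : ℝ) :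
    ∑ t ∈ Finset.Ioc u v, (Y t - L) ^ 2 = segSq Y u v + ((v : ℝ) - u) * (segMean Y u v - L) ^ 2 := by
  unfold segSq
  rw [sum_Ioc_sq_sub Y h.le, sum_Ioc_sq_sub Y h.le, sum_eq_segMean Y h]
  ring

theorem segSq_eq (Y : ℕ → ℝ) {u v : ℕ} (h : u < v) :
    segSq Y u v = ∑ t ∈ Finset.Ioc u v, Y t ^ 2 - ((v : ℝ) - u) * segMean Y u v ^ 2 := by
  have := sum_Ioc_sq_sub_eq Y h 0
  simp only [sub_zero] at this
  linarith

theorem segSq_nonneg (Y : ℕ → ℝ) (u v : ℕ) : 0 ≤ segSq Y u v :=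
  Finset.sum_nonneg fun _ _ => sq_nonneg _

theorem segSq_le (Y : ℕ → ℝ) {u v : ℕ} (h : u < v) (L : ℝ) :
    segSq Y u v ≤ ∑ t ∈ Finset.Ioc u v, (Y t - L) ^ 2 := by
  have : (u : ℝ) < v := by exact_mod_cast h
  rw [sum_Ioc_sq_sub_eq Y h]
  nlinarith [sq_nonneg (segMean Y u v - L)]

theorem mul_segMean_sub_sq_le (Y : ℕ → ℝ) {u v : ℕ} (h : u < v) (L : ℝ) :
    ((v : ℝ) - u) * (segMean Y u v - L) ^ 2 ≤ ∑ t ∈ Finset.Ioc u v, (Y t - L) ^ 2 := by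
  rw [sum_Ioc_sq_sub_eq Y h]
  linarith [segSq_nonneg Y u v]

theorem segMean_add (Y Z : ℕ → ℝ) (u v : ℕ) :
    segMean (fun t => Y t + Z t) u v = segMean Y u v + segMean Z u v := by
  simp [segMean, Finset.sum_add_distrib, add_div]

theorem contrast_add (Y Z : ℕ → ℝ) (u c v : ℕ) :
    contrast (fun t => Y t + Z t) u c v = contrast Y u c v + contrast Z u c v := by
  simp only [contrast, segMean_add]
  ring

theorem contrast_sq (Y : ℕ → ℝ) {u c v : ℕ} (huc : u < c) (hcv : c < v) :
    contrast Y u c v ^ 2 = ((c : ℝ) - u) * ((v : ℝ) - c) / ((v : ℝ) - u) *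
      (segMean Y c v - segMean Y u c) ^ 2 := by
  have h1 : (u : ℝ) < c := by exact_mod_cast huc
  have h2 : (c : ℝ) < v := by exact_mod_cast hcv
  unfold contrast
  rw [mul_pow, Real.sq_sqrt]
  exact div_nonneg (mul_nonneg (by linarith) (by linarith)) (by linarith)

/-- Decomposition into within-group and between-group variation. The squared contrast is thus the
exact gain in RSS from a cut. -/
theorem segSq_split (Y : ℕ → ℝ) {u c v : ℕ} (huc : u < c) (hcv : c < v) :
    segSq Y u v = segSq Y u c + segSq Y c v + contrast Y u c v ^ 2 := by
  have h1 : (u : ℝ) < c := by exact_mod_cast huc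
  have h2 : (c : ℝ) < v := by exact_mod_cast hcv
  have h3 : (0 : ℝ) < (v : ℝ) - u := by linarith
  have hm : ((v : ℝ) - u) * segMean Y u v =
      ((c : ℝ) - u) * segMean Y u c + ((v : ℝ) - c) * segMean Y c v := by
    rw [← sum_eq_segMean Y (huc.trans hcv), ← sum_eq_segMean Y huc, ← sum_eq_segMean Y hcv,
      Finset.sum_Ioc_consecutive Y huc.le hcv.le]
  have hm' : segMean Y u v =
      (((c : ℝ) - u) * segMean Y u c + ((v : ℝ) - c) * segMean Y c v) / ((v : ℝ) - u) := by
    rw [← hm]; field_simp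
  rw [contrast_sq Y huc hcv, segSq_eq Y (huc.trans hcv), segSq_eq Y huc, segSq_eq Y hcv,
    ← Finset.sum_Ioc_consecutive (fun t => Y t ^ 2) huc.le hcv.le, hm']
  field_simp
  ring

/-- A cut cannot gain more than the variation present. This bounds contrasts of signals that are
close to a constant. -/
theorem contrast_sq_le (Y : ℕ → ℝ) {u c v : ℕ} (huc : u < c) (hcv : c < v) (L : ℝ) :
    contrast Y u c v ^ 2 ≤ ∑ t ∈ Finset.Ioc u v, (Y t - L) ^ 2 := by
  linarith [segSq_split Y huc hcv, segSq_nonneg Y u c, segSq_nonneg Y c v,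
    segSq_le Y (huc.trans hcv) L]

theorem RSS_insert {n : ℕ} {A : Finset ℕ} (hA : A ⊆ Finset.Ioo 0 n) {u v c : ℕ}
    (h : IsSegment n A u v) (huc : u < c) (hcv : c < v) (X : ℕ → ℝ) :
    RSS n X A = RSS n X (insert c A) + contrast X u c v ^ 2 := by
  rw [RSS_eq_segSum, RSS_eq_segSum, segSum_insert hA h huc hcv, segSq_split X huc hcv]
  ring

/-- Monotonicity along inclusions reduces to single insertions, by adding the points of `B \ A` one
at a time. -/
theorem le_of_insert_le {f : Finset ℕ → ℝ} {A B : Finset ℕ} (hAB : A ⊆ B)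
    (h : ∀ D c, A ⊆ D → c ∉ D → insert c D ⊆ B → f (insert c D) ≤ f D) : f B ≤ f A := by
  have key : ∀ D : Finset ℕ, D ⊆ B \ A → f (D ∪ A) ≤ f A := by
    intro D
    induction D using Finset.induction_on with
    | empty => simp
    | insert c D hc ih =>
      intro hD
      have hD' : D ⊆ B \ A := fun x hx => hD (Finset.mem_insert_of_mem hx)
      have hcB := Finset.mem_sdiff.1 (hD (Finset.mem_insert_self c D))
      refine le_trans ?_ (ih hD')
      rw [Finset.insert_union]
      refine h _ c Finset.subset_union_right (by simp [hc, hcB.2]) ?_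
      refine Finset.insert_subset hcB.1 (Finset.union_subset ?_ hAB)
      exact hD'.trans Finset.sdiff_subset
  simpa [Finset.sdiff_union_of_subset hAB] using key _ subset_rfl

theorem RSS_antitone {n : ℕ} {A B : Finset ℕ} (hAB : A ⊆ B) (hB : B ⊆ Finset.Ioo 0 n)
    (X : ℕ → ℝ) : RSS n X B ≤ RSS n X A := by
  refine le_of_insert_le (f := RSS n X) hAB fun D c _ hc hD => ?_
  have hD' : D ⊆ Finset.Ioo 0 n := ((Finset.subset_insert c D).trans hD).trans hB
  obtain ⟨h0, h1⟩ := Finset.mem_Ioo.1 (hB (hD (Finset.mem_insert_self c D)))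
  obtain ⟨u, v, hs, hu, hv⟩ := exists_isSegment hc h0 h1
  linarith [RSS_insert hD' hs hu hv X, sq_nonneg (contrast X u c v)]

/-! ### The signal on a segment -/

namespace Signal

variable {S : Signal} {n : ℕ}

theorem IsValid.k_strictMono (h : S.IsValid n) {i j : ℕ} (hij : i < j) (hj : j ≤ S.q + 1) :
    S.k i < S.k j := by
  induction j, Nat.succ_le_of_lt hij using Nat.le_induction with
  | base => exact h.k_lt i (by omega)
  | succ m hm ih => exact (ih (by omega) (by omega)).trans (h.k_lt m (by omega))

theorem IsValid.k_mono (h : S.IsValid n) {i j : ℕ} (hij : i ≤ j) (hj : j ≤ S.q + 1) :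
    S.k i ≤ S.k j := by
  rcases hij.eq_or_lt with rfl | h1
  · exact le_rfl
  · exact (h.k_strictMono h1 hj).le

theorem IsValid.k_mem_Ioo (h : S.IsValid n) {j : ℕ} (hj : j ∈ Finset.Icc 1 S.q) :
    S.k j ∈ Finset.Ioo 0 n := by
  obtain ⟨h1, h2⟩ := Finset.mem_Icc.1 hj
  have ha := h.k_strictMono (i := 0) (j := j) (by omega) (by omega)
  have hb := h.k_strictMono (i := j) (j := S.q + 1) (by omega) le_rfl
  rw [h.k_zero] at ha
  rw [h.k_last] at hb
  exact Finset.mem_Ioo.2 ⟨ha, hb⟩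

theorem IsValid.sq_pos (h : S.IsValid n) {j : ℕ} (hj : j ∈ Finset.Icc 1 S.q) : 0 < S.d j ^ 2 :=
  by have := h.d_ne_zero j hj; positivity

/-- The value of the signal between the `p`-th and the `(p + 1)`-st change point. -/
def level (S : Signal) (p : ℕ) : ℝ := S.base + ∑ j ∈ Finset.Icc 1 p, S.d j

theorem level_succ (S : Signal) (p : ℕ) : S.level (p + 1) = S.level p + S.d (p + 1) := by
  unfold level
  rw [Finset.sum_Icc_succ_top (by omega)]
  ring

theorem IsValid.mean_eq_level (h : S.IsValid n) {p t : ℕ} (hp : p ≤ S.q) (h1 : S.k p < t)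
    (h2 : t ≤ S.k (p + 1)) : S.mean t = S.level p := by
  unfold mean level
  congr 1
  rw [← Finset.sum_filter]
  refine Finset.sum_congr ?_ fun _ _ => rfl
  ext j
  simp only [Finset.mem_filter, Finset.mem_Icc]
  constructor
  · rintro ⟨⟨h3, h4⟩, h5⟩
    refine ⟨h3, ?_⟩
    by_contra h6
    have := h.k_mono (i := p + 1) (j := j) (by omega) (by omega)
    omega
  · rintro ⟨h3, h4⟩
    have := h.k_mono (i := j) (j := p) h4 (by omega)
    omega

theorem gap_le_left (S : Signal) (j : ℕ) : S.gap j ≤ S.k j - S.k (j - 1) := min_le_left _ _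

theorem gap_le_right (S : Signal) (j : ℕ) : S.gap j ≤ S.k (j + 1) - S.k j := min_le_right _ _

theorem IsValid.add_gap_le (h : S.IsValid n) {i j : ℕ} (hi : i ≤ S.q) (hij : i < j)
    (hj : j ≤ S.q + 1) : S.k i + S.gap i ≤ S.k j := by
  have h1 := S.gap_le_right i
  have h2 := h.k_lt i hi
  have h3 := h.k_mono (i := i + 1) (j := j) (by omega) hj
  omega

theorem IsValid.gap_add_le (h : S.IsValid n) {i j : ℕ} (hij : i < j)
    (hj : j ≤ S.q + 1) : S.k i + S.gap j ≤ S.k j := by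
  have h1 := S.gap_le_left j
  have h2 := h.k_strictMono (i := j - 1) (j := j) (by omega) hj
  have h3 := h.k_mono (i := i) (j := j - 1) (by omega) (by omega)
  omega

theorem IsValid.gap_le_abs (h : S.IsValid n) {i j : ℕ} (hi : i ∈ Finset.Icc 1 S.q)
    (hj : j ∈ Finset.Icc 1 S.q) (hij : i ≠ j) :
    (S.gap i : ℝ) ≤ |(S.k i : ℝ) - S.k j| := by
  rw [Finset.mem_Icc] at hi hj
  rcases lt_or_gt_of_ne hij with h1 | h1
  · have h2 : ((S.k i + S.gap i : ℕ) : ℝ) ≤ S.k j :=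
      by exact_mod_cast h.add_gap_le (by omega) h1 (by omega)
    push_cast at h2
    rw [abs_sub_comm]
    exact le_trans (by linarith) (le_abs_self _)
  · have h2 : ((S.k j + S.gap i : ℕ) : ℝ) ≤ S.k i :=
      by exact_mod_cast h.gap_add_le h1 (by omega)
    push_cast at h2
    exact le_trans (by linarith) (le_abs_self _)

variable {G T : ℝ}

/-- A point near one change point is far from every other one. -/
theorem IsValid.far_of_near (h : S.IsValid n)
    (hG : ∀ j ∈ Finset.Icc 1 S.q, G ≤ S.d j ^ 2 * (S.gap j : ℝ)) (hTG : 2 * T ≤ G) {i j x : ℕ}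
    (hi : i ∈ Finset.Icc 1 S.q) (hj : j ∈ Finset.Icc 1 S.q) (hij : i ≠ j)
    (hx : S.d i ^ 2 * |(x : ℝ) - S.k i| ≤ T) : G / 2 ≤ S.d j ^ 2 * |(x : ℝ) - S.k j| := by
  have hdi := h.sq_pos hi
  have hdj := h.sq_pos hj
  have h1 := h.gap_le_abs hi hj hij
  have h2 := h.gap_le_abs hj hi hij.symm
  rw [abs_sub_comm] at h2
  -- `2T ≤ G` puts `x` within half of the gap of `k i`, so it stays at least half of the distance
  -- between the two change points away from `k j`.
  have h3 : |(x : ℝ) - S.k i| ≤ |(S.k i : ℝ) - S.k j| / 2 := by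
    have : S.d i ^ 2 * |(x : ℝ) - S.k i| ≤ S.d i ^ 2 * (|(S.k i : ℝ) - S.k j| / 2) := by
      nlinarith [hG i hi, mul_le_mul_of_nonneg_left h1 hdi.le]
    exact le_of_mul_le_mul_left this hdi
  have h4 : |(S.k i : ℝ) - S.k j| ≤ |(x : ℝ) - S.k i| + |(x : ℝ) - S.k j| := by
    have := abs_sub_le (S.k i : ℝ) x (S.k j)
    rwa [abs_sub_comm (S.k i : ℝ) x] at this
  nlinarith [hG j hj, mul_le_mul_of_nonneg_left h2 hdj.le,
    mul_le_mul_of_nonneg_left (show |(S.k i : ℝ) - S.k j| / 2 ≤ |(x : ℝ) - S.k j| by linarith)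
      hdj.le]

/-- The end points `0` and `n` are far from every change point. -/
theorem IsValid.far_of_end (h : S.IsValid n)
    (hG : ∀ j ∈ Finset.Icc 1 S.q, G ≤ S.d j ^ 2 * (S.gap j : ℝ)) {j x : ℕ}
    (hj : j ∈ Finset.Icc 1 S.q) (hx : x = 0 ∨ x = n) : G ≤ S.d j ^ 2 * |(x : ℝ) - S.k j| := by
  refine (hG j hj).trans (mul_le_mul_of_nonneg_left ?_ (sq_nonneg _))
  rw [Finset.mem_Icc] at hj
  rcases hx with rfl | rfl
  · have h2 : ((S.k 0 + S.gap j : ℕ) : ℝ) ≤ S.k j :=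
      by exact_mod_cast h.gap_add_le (by omega) (by omega)
    rw [h.k_zero] at h2
    rw [abs_sub_comm]
    push_cast at h2 ⊢
    exact le_trans (by linarith) (le_abs_self _)
  · have h2 : ((S.k j + S.gap j : ℕ) : ℝ) ≤ S.k (S.q + 1) :=
      by exact_mod_cast h.add_gap_le (by omega) (by omega) le_rfl
    rw [h.k_last] at h2
    push_cast at h2
    exact le_trans (by linarith) (le_abs_self _)

theorem IsValid.between_of_near (h : S.IsValid n)
    (hG : ∀ j ∈ Finset.Icc 1 S.q, G ≤ S.d j ^ 2 * (S.gap j : ℝ)) (hTG : T < G) {j x : ℕ}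
    (hj : j ∈ Finset.Icc 1 S.q) (hx : S.d j ^ 2 * |(x : ℝ) - S.k j| ≤ T) :
    S.k (j - 1) < x ∧ x < S.k (j + 1) := by
  have h1 : |(x : ℝ) - S.k j| < S.gap j :=
    lt_of_mul_lt_mul_left (lt_of_le_of_lt hx (hTG.trans_le (hG j hj))) (sq_nonneg _)
  obtain ⟨h2, h3⟩ := abs_lt.1 h1
  rw [Finset.mem_Icc] at hj
  have h4 : S.k (j - 1) + S.gap j ≤ S.k j := h.gap_add_le (by omega) (by omega)
  have h5 : S.k j + S.gap j ≤ S.k (j + 1) := h.add_gap_le (by omega) (by omega) (by omega)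
  have h6 : S.k j < x + S.gap j := by
    have : (S.k j : ℝ) < ((x + S.gap j : ℕ) : ℝ) := by push_cast; linarith
    exact_mod_cast this
  have h7 : x < S.k j + S.gap j := by
    have : (x : ℝ) < ((S.k j + S.gap j : ℕ) : ℝ) := by push_cast; linarith
    exact_mod_cast this
  omega

/-- Within `(u, v]`, the `(p + 1)`-st change point is the only one that is not close to an
end point. -/
structure Isolates (S : Signal) (n : ℕ) (T : ℝ) (p u v : ℕ) : Prop where
  lt : p < S.q
  le : v ≤ n
  lower : S.k (p - 1) ≤ u
  upper : p + 2 ≤ S.q → v ≤ S.k (p + 3)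
  left : S.d p ^ 2 * ((S.k p : ℝ) - u) ≤ T
  right : S.d (p + 2) ^ 2 * ((v : ℝ) - S.k (p + 2)) ≤ T

/-- The cut points near the two neighbouring change points cannot lie inside the segment, so they
confine its end points. No cut point near the `(p + 1)`-st change point itself is needed. -/
theorem IsValid.isolates (h : S.IsValid n)
    (hG : ∀ j ∈ Finset.Icc 1 S.q, G ≤ S.d j ^ 2 * (S.gap j : ℝ)) (hT : 0 ≤ T) (hTG : T < G)
    {A : Finset ℕ} {p u v : ℕ} (hp : p < S.q) (hs : IsSegment n A u v)
    (hA : ∀ i ∈ Finset.Icc 1 S.q, i ≠ p + 1 → ∃ a ∈ A, S.d i ^ 2 * |(a : ℝ) - S.k i| ≤ T)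
    (hu : u < S.k (p + 1)) (hv : S.k (p + 1) < v) : S.Isolates n T p u v := by
  have hl : S.k (p - 1) ≤ u ∧ S.d p ^ 2 * ((S.k p : ℝ) - u) ≤ T := by
    -- At the border there is no neighbour: `k 0 = 0 ≤ u` makes the factor of the meaningless `d 0`
    -- nonpositive. On the right, `v ≤ n = k (q + 1)` does the same for `d (q + 1)`.
    rcases Nat.eq_zero_or_pos p with rfl | hp0
    · simp only [Nat.zero_sub, h.k_zero]
      refine ⟨Nat.zero_le _, le_trans ?_ hT⟩
      push_cast
      nlinarith [sq_nonneg (S.d 0), Nat.cast_nonneg (α := ℝ) u]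
    · have hpm : p ∈ Finset.Icc 1 S.q := Finset.mem_Icc.2 ⟨hp0, hp.le⟩
      obtain ⟨a, haA, ha⟩ := hA p hpm (by omega)
      obtain ⟨h1, h2⟩ := h.between_of_near hG hTG hpm ha
      have hau : a ≤ u := by rcases hs.gap a haA with h3 | h3 <;> omega
      refine ⟨by omega, le_trans (mul_le_mul_of_nonneg_left ?_ (sq_nonneg _)) ha⟩
      have : (a : ℝ) ≤ u := by exact_mod_cast hau
      rw [abs_sub_comm]
      exact le_trans (by linarith) (le_abs_self _)
  have hr : (p + 2 ≤ S.q → v ≤ S.k (p + 3)) ∧ S.d (p + 2) ^ 2 * ((v : ℝ) - S.k (p + 2)) ≤ T := by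
    rcases Nat.lt_or_ge S.q (p + 2) with hq | hq
    · have hq' : p + 2 = S.q + 1 := by omega
      refine ⟨fun h => by omega, le_trans ?_ hT⟩
      rw [hq', h.k_last]
      have : (v : ℝ) ≤ n := by exact_mod_cast hs.le
      nlinarith [sq_nonneg (S.d (S.q + 1))]
    · have hpm : p + 2 ∈ Finset.Icc 1 S.q := Finset.mem_Icc.2 ⟨by omega, hq⟩
      obtain ⟨a, haA, ha⟩ := hA (p + 2) hpm (by omega)
      obtain ⟨h1, h2⟩ : S.k (p + 1) < a ∧ a < S.k (p + 3) := h.between_of_near hG hTG hpm ha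
      have hav : v ≤ a := by
        rcases hs.gap a haA with h3 | h3
        · omega
        · exact h3
      refine ⟨fun _ => by omega, le_trans (mul_le_mul_of_nonneg_left ?_ (sq_nonneg _)) ha⟩
      have : (v : ℝ) ≤ a := by exact_mod_cast hav
      exact le_trans (by linarith) (le_abs_self _)
  exact ⟨hp, hs.le, hl.1, hr.1, hl.2, hr.2⟩

/-- An isolating segment meets at most the pieces of the signal numbered `p - 1` to `p + 2`. The
last two indicators are the short overhangs beyond the neighbouring change points. -/
theorem IsValid.mean_eq_of_isolates (h : S.IsValid n) {p u v : ℕ} (hI : S.Isolates n T p u v)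
    {t : ℕ} (ht : t ∈ Finset.Ioc u v) :
    S.mean t = S.level p + (if S.k (p + 1) < t then S.d (p + 1) else 0)
      - (if t ≤ S.k p then S.d p else 0) + (if S.k (p + 2) < t then S.d (p + 2) else 0) := by
  obtain ⟨hut, htv⟩ := Finset.mem_Ioc.1 ht
  have hp := hI.lt
  have h01 := h.k_lt p (by omega)
  have h12 : S.k (p + 1) < S.k (p + 2) := h.k_lt (p + 1) (by omega)
  have h1 := hI.lower
  have h2 : p + 2 ≤ S.q → v ≤ S.k (p + 2 + 1) := hI.upper
  have h3 := hI.le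
  rcases Nat.lt_or_ge (S.k (p + 2)) t with ha | ha
  · have hq : p + 2 ≤ S.q := by
      by_contra hq
      have hq' : p + 2 = S.q + 1 := by omega
      rw [hq', h.k_last] at ha
      omega
    have h2 := h2 hq
    rw [h.mean_eq_level hq ha (by omega : t ≤ S.k (p + 2 + 1)), level_succ, level_succ,
      if_pos (by omega), if_neg (by omega), if_pos ha]
    ring
  rw [if_neg (by omega : ¬ S.k (p + 2) < t)]
  rcases Nat.lt_or_ge (S.k (p + 1)) t with hb | hb
  · rw [h.mean_eq_level (p := p + 1) hp hb ha, level_succ, if_pos hb, if_neg (by omega)]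
    ring
  rw [if_neg (by omega : ¬ S.k (p + 1) < t)]
  rcases Nat.lt_or_ge (S.k p) t with hc | hc
  · rw [h.mean_eq_level (p := p) (by omega) hc hb, if_neg (by omega)]
    ring
  · rw [if_pos hc]
    have hp0 : 0 < p := by
      rcases Nat.eq_zero_or_pos p with rfl | hp0
      · rw [h.k_zero] at hc; omega
      · exact hp0
    obtain ⟨r, rfl⟩ : ∃ r, p = r + 1 := ⟨p - 1, by omega⟩
    rw [h.mean_eq_level (p := r) (by omega) (by simp at h1; omega) hc, level_succ]
    ring

theorem sum_sq_le_of_support {s : Finset ℕ} {g : ℕ → ℝ} {α T : ℝ} {a b : ℕ} (hT : 0 ≤ T)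
    (hs : ∀ t ∈ s, g t ≠ 0 → t ∈ Finset.Ioc a b) (hg : ∀ t, |g t| ≤ |α|)
    (h : α ^ 2 * ((b : ℝ) - a) ≤ T) : ∑ t ∈ s, g t ^ 2 ≤ T := by
  have h1 : ∑ t ∈ s, g t ^ 2 = ∑ t ∈ s.filter (fun t => g t ≠ 0), g t ^ 2 := by
    rw [Finset.sum_filter]
    refine Finset.sum_congr rfl fun t _ => ?_
    by_cases h : g t = 0 <;> simp [h]
  have h2 : s.filter (fun t => g t ≠ 0) ⊆ Finset.Ioc a b := fun t ht =>
    hs t (Finset.mem_filter.1 ht).1 (Finset.mem_filter.1 ht).2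
  rw [h1]
  calc ∑ t ∈ s.filter (fun t => g t ≠ 0), g t ^ 2
      ≤ ∑ t ∈ Finset.Ioc a b, g t ^ 2 :=
        Finset.sum_le_sum_of_subset_of_nonneg h2 fun _ _ _ => sq_nonneg _
    _ ≤ ∑ t ∈ Finset.Ioc a b, α ^ 2 := Finset.sum_le_sum fun t _ => sq_le_sq.2 (hg t)
    _ = ((b - a : ℕ) : ℝ) * α ^ 2 := by simp
    _ ≤ T := by
        rcases Nat.lt_or_ge a b with hab | hab
        · rw [Nat.cast_sub hab.le]; linarith
        · simpa [Nat.sub_eq_zero_of_le hab] using hT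

/-- The difference from a single step at `c` consists of the two overhangs and the displacement of
the step, each of energy at most `T`; squaring a sum of three terms costs another factor 3. The
point `c` need not lie inside the segment. -/
theorem IsValid.sum_sq_mean_sub_le (h : S.IsValid n) {p u v : ℕ} (hI : S.Isolates n T p u v)
    (hT : 0 ≤ T) {c : ℕ} (hc : S.d (p + 1) ^ 2 * |(c : ℝ) - S.k (p + 1)| ≤ T) :
    ∑ t ∈ Finset.Ioc u v,
      (S.mean t - (S.level p + if c < t then S.d (p + 1) else 0)) ^ 2 ≤ 9 * T := by
  set h₁ : ℕ → ℝ := fun t => if t ≤ S.k p then S.d p else 0 with hh₁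
  set h₂ : ℕ → ℝ := fun t => if S.k (p + 2) < t then S.d (p + 2) else 0 with hh₂
  set h₃ : ℕ → ℝ := fun t => (if S.k (p + 1) < t then S.d (p + 1) else 0) -
    (if c < t then S.d (p + 1) else 0) with hh₃
  have hb₁ : ∑ t ∈ Finset.Ioc u v, h₁ t ^ 2 ≤ T := by
    refine sum_sq_le_of_support (α := S.d p) hT (a := u) (b := S.k p) ?_ ?_ hI.left
    · intro t ht hne
      have : t ≤ S.k p := by by_contra hh; simp [hh₁, hh] at hne
      exact Finset.mem_Ioc.2 ⟨(Finset.mem_Ioc.1 ht).1, this⟩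
    · intro t
      simp only [hh₁]; split_ifs <;> simp
  have hb₂ : ∑ t ∈ Finset.Ioc u v, h₂ t ^ 2 ≤ T := by
    refine sum_sq_le_of_support (α := S.d (p + 2)) hT (a := S.k (p + 2)) (b := v) ?_ ?_ hI.right
    · intro t ht hne
      have : S.k (p + 2) < t := by by_contra hh; simp [hh₂, hh] at hne
      exact Finset.mem_Ioc.2 ⟨this, (Finset.mem_Ioc.1 ht).2⟩
    · intro t
      simp only [hh₂]; split_ifs <;> simp
  have hb₃ : ∑ t ∈ Finset.Ioc u v, h₃ t ^ 2 ≤ T := by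
    refine sum_sq_le_of_support (α := S.d (p + 1)) hT (a := min c (S.k (p + 1)))
      (b := max c (S.k (p + 1))) ?_ ?_ ?_
    · intro t _ hne
      rw [Finset.mem_Ioc]
      simp only [hh₃] at hne
      split_ifs at hne <;> first | omega | simp at hne
    · intro t
      simp only [hh₃]; split_ifs <;> simp
    · push_cast
      rwa [max_sub_min_eq_abs']
  calc ∑ t ∈ Finset.Ioc u v, (S.mean t - (S.level p + if c < t then S.d (p + 1) else 0)) ^ 2
      ≤ ∑ t ∈ Finset.Ioc u v, (3 * h₁ t ^ 2 + 3 * h₂ t ^ 2 + 3 * h₃ t ^ 2) := by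
        refine Finset.sum_le_sum fun t ht => ?_
        have : S.mean t - (S.level p + if c < t then S.d (p + 1) else 0) =
            h₃ t - h₁ t + h₂ t := by
          rw [h.mean_eq_of_isolates hI ht]
          simp only [hh₁, hh₂, hh₃]
          ring
        rw [this]
        nlinarith [sq_nonneg (h₃ t + h₁ t), sq_nonneg (h₃ t - h₂ t), sq_nonneg (h₁ t + h₂ t)]
    _ ≤ 9 * T := by
        simp only [Finset.sum_add_distrib, ← Finset.mul_sum]
        linarith

/-- If every change point is close to a cut point, then the signal is almost constant on the
segments. -/
theorem IsValid.exists_const_of_segment (h : S.IsValid n)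
    (hG : ∀ j ∈ Finset.Icc 1 S.q, G ≤ S.d j ^ 2 * (S.gap j : ℝ)) (hT : 0 ≤ T) (hTG : T < G)
    {A : Finset ℕ} (hA : ∀ i ∈ Finset.Icc 1 S.q, ∃ a ∈ A, S.d i ^ 2 * |(a : ℝ) - S.k i| ≤ T)
    {u v : ℕ} (hs : IsSegment n A u v) :
    ∃ L, ∑ t ∈ Finset.Ioc u v, (S.mean t - L) ^ 2 ≤ 9 * T := by
  by_cases hex : ∃ j ∈ Finset.Icc 1 S.q, u < S.k j ∧ S.k j < v
  · obtain ⟨j, hj, hu, hv⟩ := hex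
    obtain ⟨h1, h2⟩ := Finset.mem_Icc.1 hj
    obtain ⟨p, rfl⟩ : ∃ p, j = p + 1 := ⟨j - 1, by omega⟩
    have hI := h.isolates hG hT hTG (by omega) hs (fun i hi _ => hA i hi) hu hv
    obtain ⟨a, haA, ha⟩ := hA _ hj
    have hur : (u : ℝ) < S.k (p + 1) := by exact_mod_cast hu
    have hvr : (S.k (p + 1) : ℝ) < v := by exact_mod_cast hv
    -- The cut point near the change point lies beyond an end of the segment, so that end is at
    -- least as near. A step placed at this end is constant on the segment.
    rcases hs.gap a haA with h3 | h3
    · refine ⟨S.level p + S.d (p + 1), ?_⟩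
      have h3' : (a : ℝ) ≤ u := by exact_mod_cast h3
      have := h.sum_sq_mean_sub_le hI hT (c := u)
        (le_trans (mul_le_mul_of_nonneg_left (by
          rw [abs_of_neg (by linarith)]
          exact le_trans (by linarith) (neg_le_abs _)) (sq_nonneg _)) ha)
      refine le_trans (le_of_eq (Finset.sum_congr rfl fun t ht => ?_)) this
      rw [if_pos (Finset.mem_Ioc.1 ht).1]
    · refine ⟨S.level p, ?_⟩
      have h3' : (v : ℝ) ≤ a := by exact_mod_cast h3
      have := h.sum_sq_mean_sub_le hI hT (c := v)
        (le_trans (mul_le_mul_of_nonneg_left (by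
          rw [abs_of_pos (by linarith)]
          exact le_trans (by linarith) (le_abs_self _)) (sq_nonneg _)) ha)
      refine le_trans (le_of_eq (Finset.sum_congr rfl fun t ht => ?_)) this
      rw [if_neg (by have := (Finset.mem_Ioc.1 ht).2; omega), add_zero]
  · refine ⟨S.mean v, le_trans (le_of_eq (Finset.sum_eq_zero fun t ht => ?_)) (by positivity)⟩
    obtain ⟨h1, h2⟩ := Finset.mem_Ioc.1 ht
    have : S.mean t = S.mean v := by
      unfold mean
      congr 1
      refine Finset.sum_congr rfl fun j hj => ?_
      have h3 : ¬ (u < S.k j ∧ S.k j < v) := fun h4 => hex ⟨j, hj, h4⟩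
      have : (S.k j + 1 ≤ t) ↔ (S.k j + 1 ≤ v) := by
        constructor <;> intro _ <;> omega
      simp only [this]
    simp [this]

end Signal

/-! ### Increments of the Schwarz criterion -/

/-- By `log (1 + x) ≤ x`, the decrease of the logarithmic term is at most `(n / 2) · z / (K n) ≤ ξ`.
-/
theorem SC_le_insert {n : ℕ} (hn : 0 < n) {ξ K : ℝ} (hK : 0 < K) {X : ℕ → ℝ} {A : Finset ℕ}
    (hA : A ⊆ Finset.Ioo 0 n) {u v c : ℕ} (hs : IsSegment n A u v) (huc : u < c) (hcv : c < v)
    (hlow : K * n ≤ RSS n X (insert c A)) (hcon : contrast X u c v ^ 2 ≤ 2 * K * ξ) :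
    SC n ξ X A ≤ SC n ξ X (insert c A) := by
  have hcA : c ∉ A := fun h => by rcases hs.gap c h with h1 | h1 <;> omega
  have hn' : (0 : ℝ) < n := by exact_mod_cast hn
  have hKn : 0 < K * n := by positivity
  have hins := RSS_insert hA hs huc hcv X
  unfold SC
  rw [Finset.card_insert_of_notMem hcA, hins]
  set R := RSS n X (insert c A)
  set z := contrast X u c v ^ 2
  have hR : 0 < R := hKn.trans_le hlow
  have hz : 0 ≤ z := sq_nonneg _
  have h1 : Real.log ((R + z) / n) = Real.log (R / n) + Real.log (1 + z / R) := by
    rw [← Real.log_mul (by positivity) (by positivity)]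
    congr 1
    field_simp
  have h2 : Real.log (1 + z / R) ≤ z / R := by
    have := Real.log_le_sub_one_of_pos (show 0 < 1 + z / R by positivity)
    linarith
  have h3 : (n : ℝ) / 2 * (z / R) ≤ ξ := by
    have : z / R ≤ (2 * K * ξ) / (K * n) := by
      gcongr
      exact hz.trans hcon
    calc (n : ℝ) / 2 * (z / R) ≤ (n : ℝ) / 2 * ((2 * K * ξ) / (K * n)) := by gcongr
      _ = ξ := by field_simp
  rw [h1]
  have h4 := mul_le_mul_of_nonneg_left h2 (show (0 : ℝ) ≤ (n : ℝ) / 2 by positivity)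
  push_cast
  nlinarith

/-- By `log (1 + y) ≥ y / (1 + y) ≥ y / 2` for `0 ≤ y ≤ 1`, the logarithmic term falls by at least
`τ / (4K) > ξ`. The condition `τ ≤ K n` makes `y = τ / (K n)` at most 1. -/
theorem SC_insert_lt {n : ℕ} (hn : 0 < n) {ξ K τ : ℝ} (hK : 0 < K) {X : ℕ → ℝ} {A : Finset ℕ}
    (hA : A ⊆ Finset.Ioo 0 n) {u v c : ℕ} (hs : IsSegment n A u v) (huc : u < c) (hcv : c < v)
    (hpos : 0 < RSS n X (insert c A)) (hupp : RSS n X (insert c A) ≤ K * n) (hτ : 0 < τ)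
    (hτn : τ ≤ K * n) (hτξ : 4 * K * ξ < τ) (hcon : τ ≤ contrast X u c v ^ 2) :
    SC n ξ X (insert c A) < SC n ξ X A := by
  have hcA : c ∉ A := fun h => by rcases hs.gap c h with h1 | h1 <;> omega
  have hn' : (0 : ℝ) < n := by exact_mod_cast hn
  have hKn : 0 < K * n := by positivity
  have hins := RSS_insert hA hs huc hcv X
  unfold SC
  rw [Finset.card_insert_of_notMem hcA, hins]
  set R := RSS n X (insert c A)
  set z := contrast X u c v ^ 2
  have hz : 0 ≤ z := sq_nonneg _
  have h1 : Real.log ((R + z) / n) = Real.log (R / n) + Real.log (1 + z / R) := by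
    rw [← Real.log_mul (by positivity) (by positivity)]
    congr 1
    field_simp
  set y := τ / (K * n)
  have hy : 0 < y := by positivity
  have hy1 : y ≤ 1 := (div_le_one hKn).2 hτn
  have hyz : y ≤ z / R := by
    have : τ / (K * n) ≤ τ / R := by gcongr
    exact this.trans (by gcongr)
  have h2 : y / 2 ≤ Real.log (1 + z / R) := by
    have ha := Real.one_sub_inv_le_log_of_pos (show 0 < 1 + y by positivity)
    have hb : Real.log (1 + y) ≤ Real.log (1 + z / R) :=
      Real.log_le_log (by positivity) (by linarith)
    have hc : y / 2 ≤ 1 - (1 + y)⁻¹ := by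
      rw [← sub_nonneg]
      have : 1 - (1 + y)⁻¹ - y / 2 = y * (1 - y) / (2 * (1 + y)) := by field_simp; ring
      rw [this]
      exact div_nonneg (mul_nonneg hy.le (by linarith)) (by positivity)
    linarith
  have h3 : ξ < (n : ℝ) / 2 * (y / 2) := by
    have : (n : ℝ) / 2 * (y / 2) = τ / (4 * K) := by simp only [y]; field_simp; ring
    rw [this, lt_div_iff₀ (by positivity)]
    linarith
  have h4 := mul_le_mul_of_nonneg_left h2 (show (0 : ℝ) ≤ (n : ℝ) / 2 by positivity)
  rw [h1]
  push_cast
  nlinarith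

/-! ### Noise -/

/-- The observations `X_t = f_t + e_t`. -/
def obs (S : Signal) (e : ℕ → ℝ) (t : ℕ) : ℝ := S.mean t + e t

theorem contrast_noise_sq_le {e : ℕ → ℝ} {n : ℕ} {w : ℝ}
    (hw : ∀ s t : ℕ, s < t → t ≤ n → ((t : ℝ) - s) * segMean e s t ^ 2 ≤ w ^ 2) {u c v : ℕ}
    (huc : u < c) (hcv : c < v) (hv : v ≤ n) : contrast e u c v ^ 2 ≤ 4 * w ^ 2 := by
  have h1 : (u : ℝ) < c := by exact_mod_cast huc
  have h2 : (c : ℝ) < v := by exact_mod_cast hcv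
  have ha := hw u c huc (hcv.le.trans hv)
  have hb := hw c v hcv hv
  rw [contrast_sq e huc hcv]
  set x := segMean e u c
  set y := segMean e c v
  have h3 : (y - x) ^ 2 ≤ 2 * x ^ 2 + 2 * y ^ 2 := by nlinarith [sq_nonneg (x + y)]
  have h4 : (0 : ℝ) < (v : ℝ) - u := by linarith
  have h5 : (0 : ℝ) < (c : ℝ) - u := by linarith
  have h6 : (0 : ℝ) < (v : ℝ) - c := by linarith
  calc ((c : ℝ) - u) * ((v : ℝ) - c) / ((v : ℝ) - u) * (y - x) ^ 2
      ≤ ((c : ℝ) - u) * ((v : ℝ) - c) / ((v : ℝ) - u) * (2 * x ^ 2 + 2 * y ^ 2) := by gcongr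
    _ = 2 * (((v : ℝ) - c) / ((v : ℝ) - u) * (((c : ℝ) - u) * x ^ 2)) +
        2 * (((c : ℝ) - u) / ((v : ℝ) - u) * (((v : ℝ) - c) * y ^ 2)) := by ring
    _ ≤ 2 * (1 * w ^ 2) + 2 * (1 * w ^ 2) := by
        gcongr
        · exact (div_le_one h4).2 (by linarith)
        · exact (div_le_one h4).2 (by linarith)
    _ = 4 * w ^ 2 := by ring

/-- Refine `B` by all true change points, which can only lower RSS. The signal is then constant on
each segment, and fitting a level removes at most `w²` of noise energy per segment. -/
theorem RSS_obs_ge {S : Signal} {n : ℕ} (hS : S.IsValid n) (hn : 0 < n) {e : ℕ → ℝ} {w : ℝ}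
    (hw : ∀ s t : ℕ, s < t → t ≤ n → ((t : ℝ) - s) * segMean e s t ^ 2 ≤ w ^ 2)
    {B : Finset ℕ} (hB : B ⊆ Finset.Ioo 0 n) :
    ∑ t ∈ Finset.Ioc 0 n, e t ^ 2 - ((B.card : ℝ) + S.q + 1) * w ^ 2 ≤ RSS n (obs S e) B := by
  set D := B ∪ (Finset.Icc 1 S.q).image S.k with hD
  have hDn : D ⊆ Finset.Ioo 0 n := by
    refine Finset.union_subset hB fun x hx => ?_
    obtain ⟨j, hj, rfl⟩ := Finset.mem_image.1 hx
    exact hS.k_mem_Ioo hj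
  have hcard : (D.card : ℝ) ≤ (B.card : ℝ) + S.q := by
    have h1 : D.card ≤ B.card + S.q := (Finset.card_union_le _ _).trans
      (by gcongr; exact Finset.card_image_le.trans (by simp))
    exact_mod_cast h1
  have h1 : RSS n (obs S e) D ≤ RSS n (obs S e) B :=
    RSS_antitone Finset.subset_union_left hDn _
  have h2 : ∑ t ∈ Finset.Ioc 0 n, e t ^ 2 ≤
      RSS n (obs S e) D + ((D.card : ℝ) + 1) * w ^ 2 := by
    refine le_trans ?_ (add_le_add_right (segSum_const_le n D (sq_nonneg w)) _)
    rw [← segSum_sum_Ioc hn hDn (fun t => e t ^ 2), RSS_eq_segSum, ← segSum_add]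
    refine segSum_mono hn hDn fun u v hs => ?_
    have hmean : ∀ t ∈ Finset.Ioc u v, S.mean t = S.mean v := by
      intro t ht
      obtain ⟨h1, h2⟩ := Finset.mem_Ioc.1 ht
      unfold Signal.mean
      congr 1
      refine Finset.sum_congr rfl fun j hj => ?_
      have h3 := hs.gap (S.k j) (Finset.mem_union_right _ (Finset.mem_image_of_mem _ hj))
      have : (S.k j + 1 ≤ t) ↔ (S.k j + 1 ≤ v) := by
        constructor <;> intro _ <;> omega
      simp only [this]
    have heq : segSq (obs S e) u v =
        ∑ t ∈ Finset.Ioc u v, (e t - (segMean (obs S e) u v - S.mean v)) ^ 2 :=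
      Finset.sum_congr rfl fun t ht => by rw [obs, hmean t ht]; ring
    have h4 := segSq_le e hs.lt (segMean (obs S e) u v - S.mean v)
    have h5 := segSq_eq e hs.lt
    have h6 := hw u v hs.lt hs.le
    linarith
  nlinarith [mul_le_mul_of_nonneg_right hcard (sq_nonneg w)]

theorem RSS_obs_le {S : Signal} {n : ℕ} (hn : 0 < n) {e : ℕ → ℝ} {B : Finset ℕ}
    (hB : B ⊆ Finset.Ioo 0 n) {K : ℝ} (hK : 0 ≤ K)
    (h : ∀ u v, IsSegment n B u v → ∃ L, ∑ t ∈ Finset.Ioc u v, (S.mean t - L) ^ 2 ≤ K) :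
    RSS n (obs S e) B ≤ 2 * ∑ t ∈ Finset.Ioc 0 n, e t ^ 2 + ((B.card : ℝ) + 1) * (2 * K) := by
  refine le_trans ?_ (add_le_add_right (segSum_const_le n B (by positivity)) _)
  rw [Finset.mul_sum, ← segSum_sum_Ioc hn hB, RSS_eq_segSum, ← segSum_add]
  refine segSum_mono hn hB fun u v hs => ?_
  obtain ⟨L, hL⟩ := h u v hs
  refine (segSq_le _ hs.lt L).trans ?_
  calc ∑ t ∈ Finset.Ioc u v, (obs S e t - L) ^ 2
      ≤ ∑ t ∈ Finset.Ioc u v, (2 * e t ^ 2 + 2 * (S.mean t - L) ^ 2) := by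
        refine Finset.sum_le_sum fun t _ => ?_
        unfold obs
        nlinarith [sq_nonneg (e t - (S.mean t - L))]
    _ ≤ _ := by
        rw [Finset.sum_add_distrib, ← Finset.mul_sum _ (fun t => (S.mean t - L) ^ 2)]
        linarith

/-! ### Pruning at a fixed sample size -/

/-- The properties of a sample of size `n` with noise `e` and candidates `C` on which the analysis
of the pruning algorithm rests: `ρ` is the precision of the candidates, `r` the desired precision
of the estimators, `τ` a rough precision, and `G` a lower bound on the strength of the signal. -/
structure Regular (S : Signal) (n : ℕ) (e : ℕ → ℝ) (C : Finset ℕ) (ξ w ρ r τ G κ M : ℝ) :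
    Prop where
  valid : S.IsValid n
  n_pos : 0 < n
  subset : C ⊆ Finset.Ioo 0 n
  κ_pos : 0 < κ
  M_pos : 0 < M
  strength : ∀ j ∈ Finset.Icc 1 S.q, G ≤ S.d j ^ 2 * (S.gap j : ℝ)
  noise : ∀ s t : ℕ, s < t → t ≤ n → ((t : ℝ) - s) * segMean e s t ^ 2 ≤ w ^ 2
  sum_sq_ge : κ * n ≤ ∑ t ∈ Finset.Ioc 0 n, e t ^ 2
  sum_sq_le : ∑ t ∈ Finset.Ioc 0 n, e t ^ 2 ≤ M * n
  card_w : C.Nonempty → ((C.card : ℝ) + S.q + 1) * w ^ 2 ≤ κ / 2 * n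
  card_ρ : C.Nonempty → ((C.card : ℝ) + 1) * ρ ≤ n
  near : ∀ j ∈ Finset.Icc 1 S.q, ∃ c ∈ C, S.d j ^ 2 * |(c : ℝ) - S.k j| ≤ ρ
  ρ_nonneg : 0 ≤ ρ
  ρ_le : 16 * ρ ≤ r
  r_pos : 0 < r
  penalty_r : 18 * r + 8 * w ^ 2 ≤ κ * ξ
  τ_pos : 0 < τ
  r_le_τ : 200 * r ≤ τ
  w_le_τ : 200 * w ^ 2 ≤ τ
  τ_le_G : 10000 * τ ≤ G
  penalty_τ : 100 * (2 * M + 18) * ξ < τ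
  τ_le_n : 0 < S.q → τ ≤ n
  sum_far : ∀ j ∈ Finset.Icc 1 S.q, ∀ l : ℕ, r ≤ S.d j ^ 2 * l →
    (l ≤ S.k j - S.k (j - 1) →
      16 * |∑ t ∈ Finset.Ioc (S.k j - l) (S.k j), e t| ≤ |S.d j| * l) ∧
    (l ≤ S.k (j + 1) - S.k j →
      16 * |∑ t ∈ Finset.Ioc (S.k j) (S.k j + l), e t| ≤ |S.d j| * l)
  sum_near : ∀ j ∈ Finset.Icc 1 S.q, ∀ l : ℕ, S.d j ^ 2 * l ≤ r →
    16 * (|S.d j| * |∑ t ∈ Finset.Ioc (S.k j - l) (S.k j), e t|) ≤ r ∧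
    16 * (|S.d j| * |∑ t ∈ Finset.Ioc (S.k j) (S.k j + l), e t|) ≤ r

/-- Every change point has a point of `A` in its `d_j⁻² T`-environment. -/
def Detects (S : Signal) (A : Finset ℕ) (T : ℝ) : Prop :=
  ∀ j ∈ Finset.Icc 1 S.q, ∃ a ∈ A, S.d j ^ 2 * |(a : ℝ) - S.k j| ≤ T

theorem Detects.mono {S : Signal} {A B : Finset ℕ} {T T' : ℝ} (h : Detects S A T) (hAB : A ⊆ B)
    (hT : T ≤ T') : Detects S B T' := fun j hj =>
  let ⟨a, ha, h1⟩ := h j hj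
  ⟨a, hAB ha, h1.trans hT⟩

namespace Regular

variable {S : Signal} {n : ℕ} {e : ℕ → ℝ} {C : Finset ℕ} {ξ w ρ r τ G κ M : ℝ}

theorem RSS_ge (h : Regular S n e C ξ w ρ r τ G κ M) (hC : C.Nonempty) {B : Finset ℕ}
    (hB : B ⊆ C) : κ / 2 * n ≤ RSS n (obs S e) B := by
  have h1 := RSS_obs_ge h.valid h.n_pos h.noise (hB.trans h.subset)
  have h2 := h.card_w hC
  have h3 := h.sum_sq_ge
  have h4 : (B.card : ℝ) ≤ C.card := by exact_mod_cast Finset.card_le_card hB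
  nlinarith [mul_le_mul_of_nonneg_right h4 (sq_nonneg w)]

theorem RSS_pos (h : Regular S n e C ξ w ρ r τ G κ M) (hC : C.Nonempty) {B : Finset ℕ}
    (hB : B ⊆ C) : 0 < RSS n (obs S e) B := by
  have h1 : (0 : ℝ) < n := by exact_mod_cast h.n_pos
  have := h.κ_pos
  exact lt_of_lt_of_le (by positivity) (h.RSS_ge hC hB)

/-- Once all change points are detected, further candidates do not decrease the criterion. -/
theorem mem_admissible (h : Regular S n e C ξ w ρ r τ G κ M) {A : Finset ℕ} (hA : A ⊆ C)
    (hd : Detects S A r) : A ∈ admissible n ξ (obs S e) C := by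
  refine ⟨hA, fun B B' hAB hBB' hB' => ?_⟩
  have hκ := h.κ_pos
  have hle := le_of_insert_le (f := fun D => -SC n ξ (obs S e) D) hBB' fun D c hBD hc hD => ?_
  · exact neg_le_neg_iff.1 hle
  refine neg_le_neg ?_
  have hDC : insert c D ⊆ C := hD.trans hB'
  have hD' : D ⊆ Finset.Ioo 0 n := ((Finset.subset_insert c D).trans hDC).trans h.subset
  have hcC : c ∈ C := hDC (Finset.mem_insert_self c D)
  obtain ⟨h0, h1⟩ := Finset.mem_Ioo.1 (h.subset hcC)
  obtain ⟨u, v, hs, hu, hv⟩ := exists_isSegment hc h0 h1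
  refine SC_le_insert h.n_pos (half_pos hκ) hD' hs hu hv (h.RSS_ge ⟨c, hcC⟩ hDC) ?_
  obtain ⟨L, hL⟩ := h.valid.exists_const_of_segment h.strength h.r_pos.le
    (by linarith [h.r_le_τ, h.τ_le_G, h.τ_pos, h.r_pos])
    (hd.mono (hAB.trans hBD) le_rfl) hs
  have h2 := contrast_sq_le S.mean hu hv L
  have h3 := contrast_noise_sq_le h.noise hu hv hs.le
  have h4 : contrast (obs S e) u c v = contrast S.mean u c v + contrast e u c v :=
    contrast_add S.mean e u c v
  rw [h4]
  -- The signal contrast contributes `2 · 9r` and the noise contrast `2 · 4w²`.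
  nlinarith [sq_nonneg (contrast S.mean u c v - contrast e u c v), h.penalty_r]

/-- A point within `τ` of two change points would contradict `far_of_near`, so the choice of
detecting points is injective. -/
theorem card_ge_of_detects (h : Regular S n e C ξ w ρ r τ G κ M) {A : Finset ℕ}
    (hd : Detects S A τ) : S.q ≤ A.card := by
  choose! a haA ha using hd
  have hinj : Set.InjOn a (Finset.Icc 1 S.q) := by
    intro i hi j hj hij
    by_contra hne
    have h1 := h.valid.far_of_near h.strength (by linarith [h.τ_le_G, h.τ_pos]) hi hj hne (ha i hi)
    rw [hij] at h1
    linarith [ha j hj, h.τ_le_G, h.τ_pos]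
  have h1 := Finset.card_le_card (Finset.image_subset_iff.2 haA)
  rw [Finset.card_image_of_injOn hinj] at h1
  simpa using h1

end Regular

/-! ### Gain from cutting at an undetected change point -/

/-- Points that are close to a change point lie on the same side of any point that is not. -/
theorem lt_of_lt_of_near {α H k x y z : ℝ} (hα : 0 ≤ α) (hx : H ≤ α * |x - k|)
    (hy : α * |y - k| < H) (hz : α * |z - k| < H) (hxy : x < y) : x < z := by
  by_contra! hzx
  have h1 : |x - k| ≤ max |z - k| |y - k| := abs_le_max_abs_abs (by linarith) (by linarith)
  rcases le_max_iff.1 h1 with h2 | h2 <;> nlinarith [mul_le_mul_of_nonneg_left h2 hα]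

theorem segMean_eq_const {Y : ℕ → ℝ} {u v : ℕ} {L : ℝ} (h : u < v)
    (hY : ∀ t ∈ Finset.Ioc u v, Y t = L) : segMean Y u v = L := by
  have : (0 : ℝ) < (v : ℝ) - u := sub_pos.2 (by exact_mod_cast h)
  rw [segMean, Finset.sum_congr rfl hY, Finset.sum_const, Nat.card_Ioc, nsmul_eq_mul,
    Nat.cast_sub h.le, mul_div_assoc, mul_div_cancel₀ _ this.ne']

theorem contrast_step_sq {u c v : ℕ} (huc : u < c) (hcv : c < v) (L d : ℝ) :
    contrast (fun t => L + if c < t then d else 0) u c v ^ 2 =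
      ((c : ℝ) - u) * ((v : ℝ) - c) / ((v : ℝ) - u) * d ^ 2 := by
  rw [contrast_sq _ huc hcv, segMean_eq_const (L := L + d) hcv, segMean_eq_const (L := L) huc]
  · ring
  · intro t ht
    rw [if_neg (by have := (Finset.mem_Ioc.1 ht).2; omega), add_zero]
  · intro t ht
    rw [if_pos (Finset.mem_Ioc.1 ht).1]

theorem half_min_le_mul_div_add {x y m : ℝ} (hx : 0 < x) (hy : 0 < y) (hmx : m ≤ x) (hmy : m ≤ y) :
    m / 2 ≤ x * y / (x + y) := by
  rw [le_div_iff₀ (by positivity)]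
  rcases le_total x y with h | h <;> nlinarith

namespace Regular

variable {S : Signal} {n : ℕ} {e : ℕ → ℝ} {C : Finset ℕ} {ξ w ρ r τ G κ M : ℝ}

/-- A pure step at `c` has squared contrast at least `(τ - ρ) / 2`, because both ends are far from
`c`. The rest of the signal contributes at most `9ρ` and the noise at most `4w²`, both small
fractions of `τ`. -/
theorem contrast_sq_ge (h : Regular S n e C ξ w ρ r τ G κ M) {p u v c : ℕ}
    (hI : S.Isolates n ρ p u v) (huc : u < c) (hcv : c < v)
    (hc : S.d (p + 1) ^ 2 * |(c : ℝ) - S.k (p + 1)| ≤ ρ)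
    (hu : τ ≤ S.d (p + 1) ^ 2 * |(u : ℝ) - S.k (p + 1)|)
    (hv : τ ≤ S.d (p + 1) ^ 2 * |(v : ℝ) - S.k (p + 1)|) :
    τ / 12 ≤ contrast (obs S e) u c v ^ 2 := by
  have huc' : (u : ℝ) < c := by exact_mod_cast huc
  have hcv' : (c : ℝ) < v := by exact_mod_cast hcv
  set d := S.d (p + 1) with hd
  have hdist : ∀ x : ℝ, τ ≤ d ^ 2 * |x - S.k (p + 1)| → τ - ρ ≤ d ^ 2 * |x - c| := by
    intro x hx
    have h1 := abs_sub_le x c (S.k (p + 1) : ℝ)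
    nlinarith [mul_le_mul_of_nonneg_left h1 (sq_nonneg d)]
  have h1 := hdist u hu
  have h2 := hdist v hv
  rw [abs_of_neg (by linarith), neg_sub] at h1
  rw [abs_of_pos (by linarith)] at h2
  set g : ℕ → ℝ := fun t => S.level p + if c < t then d else 0 with hg
  have hgc : (τ - ρ) / 2 ≤ contrast g u c v ^ 2 := by
    rw [hg, contrast_step_sq huc hcv]
    have hd0 : 0 < d ^ 2 := h.valid.sq_pos (Finset.mem_Icc.2 ⟨by omega, hI.lt⟩)
    have h3 := half_min_le_mul_div_add (m := (τ - ρ) / d ^ 2) (sub_pos.2 huc') (sub_pos.2 hcv')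
      ((div_le_iff₀ hd0).2 (by linarith)) ((div_le_iff₀ hd0).2 (by linarith))
    have h4 : (c : ℝ) - u + ((v : ℝ) - c) = (v : ℝ) - u := by ring
    rw [h4] at h3
    calc (τ - ρ) / 2 = (τ - ρ) / d ^ 2 / 2 * d ^ 2 := by
          rw [div_mul_eq_mul_div, div_mul_cancel₀ _ hd0.ne']
      _ ≤ _ := mul_le_mul_of_nonneg_right h3 hd0.le
  have hsplit : contrast (obs S e) u c v = contrast g u c v +
      contrast (fun t => S.mean t - g t) u c v + contrast e u c v := by
    rw [← contrast_add, ← contrast_add]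
    congr 1
    funext t
    simp [obs]
  have hrem := contrast_sq_le (fun t => S.mean t - g t) huc hcv 0
  have hsum := h.valid.sum_sq_mean_sub_le hI h.ρ_nonneg hc
  simp only [sub_zero] at hrem
  have hnoise := contrast_noise_sq_le h.noise huc hcv hI.le
  rw [hsplit]
  set x := contrast g u c v
  set y := contrast (fun t => S.mean t - g t) u c v
  set z := contrast e u c v
  have hy : y ^ 2 ≤ 9 * ρ := hrem.trans hsum
  nlinarith [sq_nonneg (x + y + z + y), sq_nonneg (x + y + z + z), sq_nonneg (y - z), h.ρ_le,
    h.r_le_τ, h.w_le_τ, h.ρ_nonneg, h.τ_pos]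

/-- If a change point is not detected, then the criterion can be decreased. -/
theorem detects_of_mem_admissible (h : Regular S n e C ξ w ρ r τ G κ M) {A : Finset ℕ}
    (hA : A ∈ admissible n ξ (obs S e) C) : Detects S A τ := by
  by_contra hnot
  simp only [Detects, not_forall, not_exists, not_and, not_le] at hnot
  obtain ⟨j, hj, hfar⟩ := hnot
  obtain ⟨hj1, hjq⟩ := Finset.mem_Icc.1 hj
  obtain ⟨p, rfl⟩ : ∃ p, j = p + 1 := ⟨j - 1, by omega⟩
  have hτ := h.τ_pos
  have hτG := h.τ_le_G
  have hρτ : 200 * ρ ≤ τ := by linarith [h.ρ_le, h.r_le_τ, h.ρ_nonneg]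
  have hMp := h.M_pos
  choose! a haC ha using h.near
  -- (C1) also concerns supersets of `A`. Resolving all other change points first leaves the missed
  -- one isolated, so that its jump cannot be cancelled by others in the same segment.
  set B := A ∪ ((Finset.Icc 1 S.q).erase (p + 1)).image a with hB
  have hBC : B ⊆ C := Finset.union_subset hA.1
    (Finset.image_subset_iff.2 fun i hi => haC i (Finset.mem_of_mem_erase hi))
  have hBfar : ∀ x ∈ B, τ ≤ S.d (p + 1) ^ 2 * |(x : ℝ) - S.k (p + 1)| := by
    intro x hx
    rcases Finset.mem_union.1 hx with hx | hx
    · exact (hfar x hx).le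
    · obtain ⟨i, hi, rfl⟩ := Finset.mem_image.1 hx
      obtain ⟨hne, hi⟩ := Finset.mem_erase.1 hi
      have := h.valid.far_of_near h.strength (by linarith) hi hj hne (ha i hi)
      linarith
  have hend : ∀ x : ℕ, x = 0 ∨ x = n → τ ≤ S.d (p + 1) ^ 2 * |(x : ℝ) - S.k (p + 1)| :=
    fun x hx => by linarith [h.valid.far_of_end h.strength hj hx]
  have hcB : a (p + 1) ∉ B := fun hc => by linarith [hBfar _ hc, ha _ hj]
  have hBn := hBC.trans h.subset
  have hCne : C.Nonempty := ⟨_, haC _ hj⟩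
  obtain ⟨h0, h1⟩ := Finset.mem_Ioo.1 (h.subset (haC _ hj))
  obtain ⟨u, v, hs, huc, hcv⟩ := exists_isSegment hcB h0 h1
  have hufar : τ ≤ S.d (p + 1) ^ 2 * |(u : ℝ) - S.k (p + 1)| := by
    rcases Finset.mem_insert.1 hs.left with hu | hu
    · exact hend u (Or.inl hu)
    · exact hBfar u hu
  have hvfar : τ ≤ S.d (p + 1) ^ 2 * |(v : ℝ) - S.k (p + 1)| := by
    rcases hs.right with hv | hv
    · exact hBfar v hv
    · exact hend v (Or.inr hv)
  have hclose : S.d (p + 1) ^ 2 * |(a (p + 1) : ℝ) - S.k (p + 1)| < τ := by linarith [ha _ hj]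
  have hself : S.d (p + 1) ^ 2 * |(S.k (p + 1) : ℝ) - S.k (p + 1)| < τ := by simpa using hτ
  have huk : u < S.k (p + 1) := by
    exact_mod_cast lt_of_lt_of_near (sq_nonneg _) hufar hclose hself
      (show (u : ℝ) < a (p + 1) by exact_mod_cast huc)
  have hkv : S.k (p + 1) < v := by
    by_contra hvk
    have hvk' : v < S.k (p + 1) := by
      refine lt_of_le_of_ne (not_lt.1 hvk) fun heq => ?_
      rw [heq] at hvfar
      linarith
    have : (v : ℝ) < a (p + 1) := lt_of_lt_of_near (sq_nonneg _) hvfar hself hclose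
      (by exact_mod_cast hvk')
    have : v < a (p + 1) := by exact_mod_cast this
    omega
  have hI : S.Isolates n ρ p u v := h.valid.isolates h.strength h.ρ_nonneg (by linarith) (by omega)
    hs (fun i hi hne => ⟨a i, Finset.mem_union_right _
      (Finset.mem_image_of_mem _ (Finset.mem_erase.2 ⟨hne, hi⟩)), ha i hi⟩) huk hkv
  have hcon := h.contrast_sq_ge hI huc hcv (ha _ hj) hufar hvfar
  set B' := insert (a (p + 1)) B with hB'
  have hB'C : B' ⊆ C := Finset.insert_subset (haC _ hj) hBC
  have hdet : Detects S B' ρ := fun i hi => by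
    by_cases hne : i = p + 1
    · exact ⟨a i, by rw [hne]; exact Finset.mem_insert_self _ _, ha i hi⟩
    · exact ⟨a i, Finset.mem_insert_of_mem (Finset.mem_union_right _
        (Finset.mem_image_of_mem _ (Finset.mem_erase.2 ⟨hne, hi⟩))), ha i hi⟩
  -- Twice the noise energy gives `2M`; twice `9ρ` on each of at most `|C| + 1` segments gives `18`.
  have hupp : RSS n (obs S e) B' ≤ (2 * M + 18) * n := by
    have h2 := RSS_obs_le (S := S) h.n_pos (e := e) (hB'C.trans h.subset)
      (K := 9 * ρ) (by linarith [h.ρ_nonneg])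
      fun u v hs => h.valid.exists_const_of_segment h.strength h.ρ_nonneg (by linarith) hdet hs
    have h3 : (B'.card : ℝ) ≤ C.card := by exact_mod_cast Finset.card_le_card hB'C
    have h4 := h.card_ρ hCne
    nlinarith [h.sum_sq_le, mul_le_mul_of_nonneg_right h3 h.ρ_nonneg]
  have hn : (0 : ℝ) < n := by exact_mod_cast h.n_pos
  have hlt := SC_insert_lt (ξ := ξ) h.n_pos (K := 2 * M + 18) (τ := τ / 12) (by linarith) hBn hs
    huc hcv (h.RSS_pos hCne hB'C) hupp (by positivity) (by nlinarith [h.τ_le_n (by omega)])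
    (by linarith [h.penalty_τ]) hcon
  exact absurd (hA.2 B B' Finset.subset_union_left (Finset.subset_insert _ _) hB'C) (not_le.2 hlt)

end Regular

/-! ### Local improvement of an estimator -/

/-- This is the gain of an exchange of cut points: `x`, `y` are errors of the two segment means, `N`
is the length of the moved stretch, `D` its wrongly assigned signal and `E` its noise. For `d > 0`
the main term is at least `(3/4)(15/16) d l`, while `2|D| + 2|E| ≤ (3/8) d l`. -/
theorem swap_gain_pos {d x y l N D E : ℝ} (hd : d ≠ 0) (hl : 0 < l) (hx : |x| ≤ |d| / 8)
    (hy : |y| ≤ |d| / 8) (hN : 15 / 16 * l ≤ N) (hD : |D| ≤ |d| * l / 16)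
    (hE : |E| ≤ |d| * l / 8) : 0 < (d + y - x) * (N * (d - x - y) + 2 * D + 2 * E) := by
  have key : ∀ d x y D E : ℝ, 0 < d → |x| ≤ d / 8 → |y| ≤ d / 8 → |D| ≤ d * l / 16 →
      |E| ≤ d * l / 8 → 0 < (d + y - x) * (N * (d - x - y) + 2 * D + 2 * E) := by
    intro d x y D E hd hx hy hD hE
    rw [abs_le] at hx hy hD hE
    have h1 : 0 < d * l := mul_pos hd hl
    have h2 : 3 / 4 * d * (15 / 16 * l) ≤ (d - x - y) * N :=
      mul_le_mul (by linarith) hN (by positivity) (by linarith)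
    exact mul_pos (by linarith) (by nlinarith)
  rcases lt_or_gt_of_ne hd with h | h
  · rw [abs_of_neg h] at hx hy hD hE
    have := key (-d) (-x) (-y) (-D) (-E) (by linarith) (by rwa [abs_neg]) (by rwa [abs_neg])
      (by rwa [abs_neg]) (by rwa [abs_neg])
    linarith
  · rw [abs_of_pos h] at hx hy hD hE
    exact key d x y D E h hx hy hD hE

/-- Moving the split point `a` of `(u, v]` to the left. -/
theorem segSq_swap_left_ge (X : ℕ → ℝ) {u c a v : ℕ} (huc : u < c) (hca : c < a) (hav : a < v) :
    segSq X u c + segSq X c v + (segMean X a v - segMean X u a) *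
        (2 * ∑ t ∈ Finset.Ioc c a, X t - ((a : ℝ) - c) * (segMean X u a + segMean X a v)) ≤
      segSq X u a + segSq X a v := by
  set x := segMean X u a with hx
  set y := segMean X a v with hy
  -- The new segments are compared at the old means `x` and `y`, which overestimates their
  -- residuals. Only the stretch `(c, a]` then changes its contribution.
  have h1 := segSq_le X huc x
  have h2 := segSq_le X (hca.trans hav) y
  rw [← Finset.sum_Ioc_consecutive _ hca.le hav.le] at h2
  have h3 : segSq X u a =
      ∑ t ∈ Finset.Ioc u c, (X t - x) ^ 2 + ∑ t ∈ Finset.Ioc c a, (X t - x) ^ 2 :=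
    (Finset.sum_Ioc_consecutive _ huc.le hca.le).symm
  have h4 : segSq X a v = ∑ t ∈ Finset.Ioc a v, (X t - y) ^ 2 := rfl
  have h5 := sum_Ioc_sq_sub X hca.le x
  have h6 := sum_Ioc_sq_sub X hca.le y
  rw [h3, h4]
  linarith

/-- Moving the split point `a` of `(u, v]` to the right. -/
theorem segSq_swap_right_ge (X : ℕ → ℝ) {u c a v : ℕ} (hua : u < a) (hac : a < c) (hcv : c < v) :
    segSq X u c + segSq X c v - (segMean X a v - segMean X u a) *
        (2 * ∑ t ∈ Finset.Ioc a c, X t - ((c : ℝ) - a) * (segMean X u a + segMean X a v)) ≤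
      segSq X u a + segSq X a v := by
  set x := segMean X u a with hx
  set y := segMean X a v with hy
  have h1 := segSq_le X hcv y
  have h2 := segSq_le X (hua.trans hac) x
  rw [← Finset.sum_Ioc_consecutive _ hua.le hac.le] at h2
  have h3 : segSq X a v =
      ∑ t ∈ Finset.Ioc a c, (X t - y) ^ 2 + ∑ t ∈ Finset.Ioc c v, (X t - y) ^ 2 :=
    (Finset.sum_Ioc_consecutive _ hac.le hcv.le).symm
  have h4 : segSq X u a = ∑ t ∈ Finset.Ioc u a, (X t - x) ^ 2 := rfl
  have h5 := sum_Ioc_sq_sub X hac.le x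
  have h6 := sum_Ioc_sq_sub X hac.le y
  rw [h3, h4]
  linarith

theorem abs_sum_Ioc_le_of_support {g : ℕ → ℝ} {s : Finset ℕ} {α : ℝ} {a b : ℕ}
    (hs : ∀ t ∈ s, g t ≠ 0 → t ∈ Finset.Ioc a b) (hg : ∀ t, |g t| ≤ |α|) :
    |∑ t ∈ s, g t| ≤ |α| * |(b : ℝ) - a| := by
  calc |∑ t ∈ s, g t| ≤ ∑ t ∈ s, |g t| := Finset.abs_sum_le_sum_abs _ _
    _ = ∑ t ∈ s.filter (fun t => g t ≠ 0), |g t| := by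
        rw [Finset.sum_filter]
        refine Finset.sum_congr rfl fun t _ => ?_
        by_cases h : g t = 0 <;> simp [h]
    _ ≤ ∑ t ∈ Finset.Ioc a b, |g t| := Finset.sum_le_sum_of_subset_of_nonneg
        (fun t ht => hs t (Finset.mem_filter.1 ht).1 (Finset.mem_filter.1 ht).2)
        fun _ _ _ => abs_nonneg _
    _ ≤ ∑ t ∈ Finset.Ioc a b, |α| := Finset.sum_le_sum fun t _ => hg t
    _ = |α| * ((b - a : ℕ) : ℝ) := by simp [mul_comm]
    _ ≤ |α| * |(b : ℝ) - a| := by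
        gcongr
        rcases Nat.lt_or_ge a b with hab | hab
        · rw [Nat.cast_sub hab.le]; exact le_abs_self _
        · simp [Nat.sub_eq_zero_of_le hab]

namespace Regular

variable {S : Signal} {n : ℕ} {e : ℕ → ℝ} {C : Finset ℕ} {ξ w ρ r τ G κ M : ℝ}

/-- Signal and noise each shift the mean by at most `|d| / 16`. For the signal this needs `9 · 256 ·
τ ≤ G / 4`, which accounts for the factor 10000 between `τ` and `G`. -/
theorem abs_segMean_sub_le (h : Regular S n e C ξ w ρ r τ G κ M) {u v : ℕ} (huv : u < v)
    (hv : v ≤ n) {L d : ℝ} (hL : ∑ t ∈ Finset.Ioc u v, (S.mean t - L) ^ 2 ≤ 9 * τ)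
    (hG : G ≤ 4 * (d ^ 2 * ((v : ℝ) - u))) : |segMean (obs S e) u v - L| ≤ |d| / 8 := by
  have hlen : (0 : ℝ) < (v : ℝ) - u := sub_pos.2 (by exact_mod_cast huv)
  have h1 := (mul_segMean_sub_sq_le S.mean huv L).trans hL
  have h2 := h.noise u v huv hv
  have h3 : segMean (obs S e) u v = segMean S.mean u v + segMean e u v := segMean_add _ _ _ _
  have h4 : |segMean S.mean u v - L| ≤ |d| / 16 := by
    have : (segMean S.mean u v - L) ^ 2 ≤ (d / 16) ^ 2 := by
      refine le_of_mul_le_mul_left ?_ hlen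
      nlinarith [h.τ_le_G]
    have := sq_le_sq.1 this
    rwa [abs_div, abs_of_pos (by norm_num : (0 : ℝ) < 16)] at this
  have h5 : |segMean e u v| ≤ |d| / 16 := by
    have : (segMean e u v) ^ 2 ≤ (d / 16) ^ 2 := by
      refine le_of_mul_le_mul_left ?_ hlen
      nlinarith [h.τ_le_G, h.w_le_τ, sq_nonneg w]
    have := sq_le_sq.1 this
    rwa [abs_div, abs_of_pos (by norm_num : (0 : ℝ) < 16)] at this
  rw [h3]
  calc |segMean S.mean u v + segMean e u v - L|
      = |(segMean S.mean u v - L) + segMean e u v| := by congr 1; ring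
    _ ≤ |segMean S.mean u v - L| + |segMean e u v| := abs_add_le _ _
    _ ≤ |d| / 8 := by linarith

/-- With `l = |a - k|`, exchanging `a` for `c` gains an amount of order `d² l`. The noise between
`k` and `a` is controlled by `sum_far` because `d² l > r`, and that between `k` and `c` by
`sum_near` because `ρ ≤ r`; each is at most `|d| l / 16`. -/
theorem segSq_swap_lt (h : Regular S n e C ξ w ρ r τ G κ M) {p u v a c : ℕ}
    (hI : S.Isolates n τ p u v) (hua : u < a) (hav : a < v) (huc : u < c) (hcv : c < v)
    (hc : S.d (p + 1) ^ 2 * |(c : ℝ) - S.k (p + 1)| ≤ ρ)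
    (ha : S.d (p + 1) ^ 2 * |(a : ℝ) - S.k (p + 1)| ≤ τ)
    (har : r < S.d (p + 1) ^ 2 * |(a : ℝ) - S.k (p + 1)|)
    (hu : G / 2 ≤ S.d (p + 1) ^ 2 * |(u : ℝ) - S.k (p + 1)|)
    (hv : G / 2 ≤ S.d (p + 1) ^ 2 * |(v : ℝ) - S.k (p + 1)|) :
    segSq (obs S e) u c + segSq (obs S e) c v < segSq (obs S e) u a + segSq (obs S e) a v := by
  have hp := hI.lt
  have hpm : p + 1 ∈ Finset.Icc 1 S.q := Finset.mem_Icc.2 ⟨by omega, hp⟩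
  have hτ := h.τ_pos
  have hτG := h.τ_le_G
  have hr := h.r_pos
  have hρr := h.ρ_le
  have hrτ := h.r_le_τ
  obtain ⟨ha1, ha2⟩ : S.k p < a ∧ a < S.k (p + 2) :=
    h.valid.between_of_near h.strength (by linarith) hpm ha
  obtain ⟨hc1, hc2⟩ : S.k p < c ∧ c < S.k (p + 2) :=
    h.valid.between_of_near h.strength (T := ρ) (by linarith [h.ρ_nonneg]) hpm hc
  have hd0 := h.valid.sq_pos hpm
  have hdne := h.valid.d_ne_zero _ hpm
  have hfar := h.sum_far (p + 1) hpm
  have hnear := h.sum_near (p + 1) hpm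
  have hsq := h.valid.sum_sq_mean_sub_le hI hτ.le ha
  set k := S.k (p + 1) with hk
  set d := S.d (p + 1) with hd
  set L := S.level p with hL
  have huar : (u : ℝ) < a := by exact_mod_cast hua
  have havr : (a : ℝ) < v := by exact_mod_cast hav
  have hlen : ∀ x : ℝ, G / 2 ≤ d ^ 2 * |x - k| → G ≤ 4 * (d ^ 2 * |x - a|) := by
    intro x hx
    have h1 := abs_sub_le x a (k : ℝ)
    nlinarith [mul_le_mul_of_nonneg_left h1 (sq_nonneg d)]
  have hlu := hlen u hu
  have hlv := hlen v hv
  rw [abs_of_neg (by linarith), neg_sub] at hlu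
  rw [abs_of_pos (by linarith)] at hlv
  rw [← Finset.sum_Ioc_consecutive _ hua.le hav.le] at hsq
  have hsq1 : ∑ t ∈ Finset.Ioc u a, (S.mean t - L) ^ 2 ≤ 9 * τ := by
    refine le_trans (le_trans (le_of_eq (Finset.sum_congr rfl fun t ht => ?_))
      (le_add_of_nonneg_right (Finset.sum_nonneg fun t _ => sq_nonneg _))) hsq
    rw [if_neg (by have := (Finset.mem_Ioc.1 ht).2; omega), add_zero]
  have hsq2 : ∑ t ∈ Finset.Ioc a v, (S.mean t - (L + d)) ^ 2 ≤ 9 * τ := by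
    refine le_trans (le_trans (le_of_eq (Finset.sum_congr rfl fun t ht => ?_))
      (le_add_of_nonneg_left (Finset.sum_nonneg fun t _ => sq_nonneg _))) hsq
    rw [if_pos (Finset.mem_Ioc.1 ht).1]
  have hx := h.abs_segMean_sub_le hua (hav.le.trans hI.le) hsq1 hlu
  have hy := h.abs_segMean_sub_le hav hI.le hsq2 hlv
  set μ₁ := segMean (obs S e) u a
  set μ₂ := segMean (obs S e) a v
  have hmeanL : ∀ t, S.k p < t → t ≤ k → S.mean t = L := fun t h1 h2 =>
    h.valid.mean_eq_level hp.le h1 h2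
  have hmeanR : ∀ t, k < t → t ≤ S.k (p + 2) → S.mean t = L + d := fun t h1 h2 => by
    rw [h.valid.mean_eq_level (p := p + 1) hp h1 h2, Signal.level_succ]
  have hcr : |(c : ℝ) - k| < |(a : ℝ) - k| :=
    lt_of_mul_lt_mul_left (lt_of_le_of_lt hc (by linarith)) hd0.le
  -- From `16ρ ≤ r`: the misassigned stretch between `c` and `k` is a small part of `l`.
  have hcl : |(c : ℝ) - k| ≤ |(a : ℝ) - k| / 16 := by
    refine le_of_mul_le_mul_left (?_ : d ^ 2 * _ ≤ d ^ 2 * _) hd0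
    linarith
  have hl : 0 < |(a : ℝ) - k| := lt_of_le_of_lt (abs_nonneg _) hcr
  have hsmall : ∀ E : ℝ, 16 * (|d| * |E|) ≤ r → |E| ≤ |d| * |(a : ℝ) - k| / 16 := by
    intro E hE
    refine le_of_mul_le_mul_left (?_ : |d| * _ ≤ |d| * _) (abs_pos.2 hdne)
    have : |d| * (|d| * |(a : ℝ) - k| / 16) = d ^ 2 * |(a : ℝ) - k| / 16 := by
      rw [← sq_abs d]; ring
    linarith
  have hEc1 : c ≤ k → |∑ t ∈ Finset.Ioc c k, e t| ≤ |d| * |(a : ℝ) - k| / 16 := by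
    intro hck
    refine hsmall _ ?_
    have h1 := (hnear (k - c) ?_).1
    · rwa [Nat.sub_sub_self hck] at h1
    · rw [Nat.cast_sub hck]
      rw [abs_sub_comm, abs_of_nonneg (sub_nonneg.2 (by exact_mod_cast hck))] at hc
      linarith
  have hEc2 : k ≤ c → |∑ t ∈ Finset.Ioc k c, e t| ≤ |d| * |(a : ℝ) - k| / 16 := by
    intro hkc
    refine hsmall _ ?_
    have h1 := (hnear (c - k) ?_).2
    · rwa [Nat.add_sub_cancel' hkc] at h1
    · rw [Nat.cast_sub hkc]
      rw [abs_of_nonneg (sub_nonneg.2 (by exact_mod_cast hkc))] at hc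
      linarith
  rcases Nat.lt_or_ge k a with hka | hak
  · have hkar : (k : ℝ) < a := by exact_mod_cast hka
    have habs : |(a : ℝ) - k| = a - k := abs_of_pos (by linarith)
    have hca : c < a := by
      rw [habs] at hcr
      have : (c : ℝ) < a := by linarith [le_abs_self ((c : ℝ) - k)]
      exact_mod_cast this
    have hEa : |∑ t ∈ Finset.Ioc k a, e t| ≤ |d| * |(a : ℝ) - k| / 16 := by
      have h1 := (hfar (a - k) ?_).2 (Nat.sub_le_sub_right ha2.le k)
      · rw [Nat.add_sub_cancel' hka.le, Nat.cast_sub hka.le] at h1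
        rw [habs]; linarith
      · rw [Nat.cast_sub hka.le, ← habs]; exact har.le
    have hE : |∑ t ∈ Finset.Ioc c a, e t| ≤ |d| * |(a : ℝ) - k| / 8 := by
      rcases le_total c k with hck | hkc
      · rw [← Finset.sum_Ioc_consecutive _ hck hka.le]
        linarith [abs_add_le (∑ t ∈ Finset.Ioc c k, e t) (∑ t ∈ Finset.Ioc k a, e t), hEc1 hck]
      · have h1 := Finset.sum_Ioc_consecutive e hkc hca.le
        have h2 : ∑ t ∈ Finset.Ioc c a, e t =
          ∑ t ∈ Finset.Ioc k a, e t - ∑ t ∈ Finset.Ioc k c, e t := by linarith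
        rw [h2]
        linarith [abs_sub (∑ t ∈ Finset.Ioc k a, e t) (∑ t ∈ Finset.Ioc k c, e t), hEc2 hkc]
    have hD : |∑ t ∈ Finset.Ioc c a, (if t ≤ k then -d else 0)| ≤ |d| * |(a : ℝ) - k| / 16 := by
      have h1 := abs_sum_Ioc_le_of_support (g := fun t => if t ≤ k then -d else 0)
        (s := Finset.Ioc c a) (α := d) (a := c) (b := k) ?_ ?_
      · rw [abs_sub_comm (k : ℝ)] at h1
        nlinarith [abs_nonneg d]
      · intro t ht hne
        have : t ≤ k := by by_contra hh; simp [hh] at hne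
        exact Finset.mem_Ioc.2 ⟨(Finset.mem_Ioc.1 ht).1, this⟩
      · intro t; split_ifs <;> simp
    have hX : ∑ t ∈ Finset.Ioc c a, obs S e t = ((a : ℝ) - c) * (L + d) +
        ∑ t ∈ Finset.Ioc c a, (if t ≤ k then -d else 0) + ∑ t ∈ Finset.Ioc c a, e t := by
      have h1 : ((a : ℝ) - c) * (L + d) = ∑ t ∈ Finset.Ioc c a, (L + d) := by
        rw [Finset.sum_const, Nat.card_Ioc, nsmul_eq_mul, Nat.cast_sub hca.le]
      rw [h1, ← Finset.sum_add_distrib, ← Finset.sum_add_distrib]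
      refine Finset.sum_congr rfl fun t ht => ?_
      obtain ⟨h2, h3⟩ := Finset.mem_Ioc.1 ht
      unfold obs
      split_ifs with htk
      · rw [hmeanL t (by omega) htk]; ring
      · rw [hmeanR t (by omega) (by omega)]; ring
    have hgain := swap_gain_pos hdne hl hx hy (N := (a : ℝ) - c)
      (by linarith [le_abs_self ((c : ℝ) - k)]) hD hE
    have hswap := segSq_swap_left_ge (obs S e) huc hca hav
    rw [hX] at hswap
    linarith
  · have hak' : a < k := lt_of_le_of_ne hak fun heq => by rw [heq] at hl; simp at hl
    have hkar : (a : ℝ) < k := by exact_mod_cast hak'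
    have habs : |(a : ℝ) - k| = k - a := by rw [abs_of_neg (by linarith)]; ring
    have hac : a < c := by
      rw [habs] at hcr
      have : (a : ℝ) < c := by linarith [neg_abs_le ((c : ℝ) - k)]
      exact_mod_cast this
    have hEa : |∑ t ∈ Finset.Ioc a k, e t| ≤ |d| * |(a : ℝ) - k| / 16 := by
      have h1 := (hfar (k - a) ?_).1 (Nat.sub_le_sub_left ha1.le k)
      · rw [Nat.sub_sub_self hak'.le, Nat.cast_sub hak'.le] at h1
        rw [habs]; linarith
      · rw [Nat.cast_sub hak'.le, ← habs]; exact har.le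
    have hE : |-∑ t ∈ Finset.Ioc a c, e t| ≤ |d| * |(a : ℝ) - k| / 8 := by
      rw [abs_neg]
      rcases le_total k c with hkc | hck
      · rw [← Finset.sum_Ioc_consecutive _ hak'.le hkc]
        linarith [abs_add_le (∑ t ∈ Finset.Ioc a k, e t) (∑ t ∈ Finset.Ioc k c, e t), hEc2 hkc]
      · have h1 := Finset.sum_Ioc_consecutive e hac.le hck
        have h2 : ∑ t ∈ Finset.Ioc a c, e t =
          ∑ t ∈ Finset.Ioc a k, e t - ∑ t ∈ Finset.Ioc c k, e t := by linarith
        rw [h2]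
        linarith [abs_sub (∑ t ∈ Finset.Ioc a k, e t) (∑ t ∈ Finset.Ioc c k, e t), hEc1 hck]
    have hD : |-∑ t ∈ Finset.Ioc a c, (if k < t then d else 0)| ≤ |d| * |(a : ℝ) - k| / 16 := by
      have h1 := abs_sum_Ioc_le_of_support (g := fun t => if k < t then d else 0)
        (s := Finset.Ioc a c) (α := d) (a := k) (b := c) ?_ ?_
      · rw [abs_neg]
        nlinarith [abs_nonneg d]
      · intro t ht hne
        have : k < t := by by_contra hh; simp [hh] at hne
        exact Finset.mem_Ioc.2 ⟨this, (Finset.mem_Ioc.1 ht).2⟩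
      · intro t; split_ifs <;> simp
    have hX : ∑ t ∈ Finset.Ioc a c, obs S e t = ((c : ℝ) - a) * L +
        ∑ t ∈ Finset.Ioc a c, (if k < t then d else 0) + ∑ t ∈ Finset.Ioc a c, e t := by
      have h1 : ((c : ℝ) - a) * L = ∑ t ∈ Finset.Ioc a c, L := by
        rw [Finset.sum_const, Nat.card_Ioc, nsmul_eq_mul, Nat.cast_sub hac.le]
      rw [h1, ← Finset.sum_add_distrib, ← Finset.sum_add_distrib]
      refine Finset.sum_congr rfl fun t ht => ?_
      obtain ⟨h2, h3⟩ := Finset.mem_Ioc.1 ht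
      unfold obs
      split_ifs with htk
      · rw [hmeanR t htk (by omega)]
      · rw [hmeanL t (by omega) (by omega)]; ring
    -- Reflection in time: for a move to the right the two mean errors exchange roles and change
    -- sign.
    rw [← abs_neg] at hx hy
    have hgain := swap_gain_pos hdne hl hy hx (N := (c : ℝ) - a)
      (by linarith [neg_abs_le ((c : ℝ) - k)]) hD hE
    have hswap := segSq_swap_right_ge (obs S e) hua hac hcv
    rw [hX] at hswap
    linarith

end Regular

/-! ### Consistency at a fixed sample size -/

/-- Exactly `j - 1` elements of the image lie below `a j`, and `Nat.nth` counts from zero. -/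
theorem estimate_image {a : ℕ → ℕ} {q j : ℕ}
    (hmono : ∀ i ∈ Finset.Icc 1 q, ∀ j ∈ Finset.Icc 1 q, i < j → a i < a j)
    (hj : j ∈ Finset.Icc 1 q) : estimate ((Finset.Icc 1 q).image a) j = a j := by
  have hlt : ∀ i ∈ Finset.Icc 1 q, ∀ j ∈ Finset.Icc 1 q, a i < a j → i < j := by
    intro i hi j hj hij
    by_contra! hji
    rcases hji.eq_or_lt with rfl | h
    · omega
    · have := hmono j hj i hi h; omega
  have hcount : Nat.count (fun x => x ∈ (Finset.Icc 1 q).image a) (a j) = j - 1 := by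
    rw [Nat.count_eq_card_filter_range]
    have heq : (Finset.range (a j)).filter (fun x => x ∈ (Finset.Icc 1 q).image a) =
        (Finset.Icc 1 (j - 1)).image a := by
      rw [Finset.mem_Icc] at hj
      ext x
      simp only [Finset.mem_filter, Finset.mem_range, Finset.mem_image]
      constructor
      · rintro ⟨hx, i, hi, rfl⟩
        have h1 := hlt i hi j (Finset.mem_Icc.2 hj) hx
        rw [Finset.mem_Icc] at hi
        exact ⟨i, Finset.mem_Icc.2 (by omega), rfl⟩
      · rintro ⟨i, hi, rfl⟩
        rw [Finset.mem_Icc] at hi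
        have hi' : i ∈ Finset.Icc 1 q := Finset.mem_Icc.2 (by omega)
        exact ⟨hmono i hi' j (Finset.mem_Icc.2 hj) (by omega), i, hi', rfl⟩
    rw [heq, Finset.card_image_of_injOn]
    · simp
    · intro x hx y hy hxy
      rw [Finset.mem_coe, Finset.mem_Icc] at hx hy
      rw [Finset.mem_Icc] at hj
      have hx' : x ∈ Finset.Icc 1 q := Finset.mem_Icc.2 (by omega)
      have hy' : y ∈ Finset.Icc 1 q := Finset.mem_Icc.2 (by omega)
      rcases lt_trichotomy x y with h | h | h
      · have := hmono x hx' y hy' h; omega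
      · exact h
      · have := hmono y hy' x hx' h; omega
  have hmem : a j ∈ (Finset.Icc 1 q).image a := Finset.mem_image_of_mem a hj
  unfold estimate
  rw [← hcount]
  exact Nat.nth_count (p := fun x => x ∈ (Finset.Icc 1 q).image a) hmem

namespace Regular

variable {S : Signal} {n : ℕ} {e : ℕ → ℝ} {C : Finset ℕ} {ξ w ρ r τ G κ M : ℝ}

theorem lt_of_near (h : Regular S n e C ξ w ρ r τ G κ M) {i j x y : ℕ}
    (hi : i ∈ Finset.Icc 1 S.q) (hj : j ∈ Finset.Icc 1 S.q) (hij : i < j)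
    (hx : S.d i ^ 2 * |(x : ℝ) - S.k i| ≤ τ) (hy : S.d j ^ 2 * |(y : ℝ) - S.k j| ≤ τ) :
    x < y := by
  have hhalf : ∀ j ∈ Finset.Icc 1 S.q, ∀ y : ℕ, S.d j ^ 2 * |(y : ℝ) - S.k j| ≤ τ →
      |(y : ℝ) - S.k j| < S.gap j / 2 := by
    intro j hj y hy
    refine lt_of_mul_lt_mul_left (?_ : S.d j ^ 2 * _ < S.d j ^ 2 * _) (sq_nonneg _)
    have := h.strength j hj
    linarith [h.τ_pos, h.τ_le_G]
  have h1 := hhalf i hi x hx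
  have h2 := hhalf j hj y hy
  have h3 := h.valid.gap_le_abs hi hj hij.ne
  have h4 := h.valid.gap_le_abs hj hi hij.ne'
  have h5 : (S.k i : ℝ) < S.k j := by
    exact_mod_cast h.valid.k_strictMono hij (by have := (Finset.mem_Icc.1 hj).2; omega)
  rw [abs_of_neg (by linarith)] at h3
  rw [abs_of_pos (by linarith)] at h4
  have : (x : ℝ) < y := by linarith [(abs_lt.1 h1).2, (abs_lt.1 h2).1]
  exact_mod_cast this

/-- Detecting points of different change points are distinct and ordered like them, so with at most
`q` elements `A` has no others. -/
theorem exists_enumeration (h : Regular S n e C ξ w ρ r τ G κ M) {A : Finset ℕ} {T : ℝ}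
    (hT : T ≤ τ) (hd : Detects S A T) (hcard : A.card ≤ S.q) :
    ∃ a : ℕ → ℕ, A = (Finset.Icc 1 S.q).image a ∧
      (∀ j ∈ Finset.Icc 1 S.q, S.d j ^ 2 * |(a j : ℝ) - S.k j| ≤ T) ∧
      ∀ i ∈ Finset.Icc 1 S.q, ∀ j ∈ Finset.Icc 1 S.q, i < j → a i < a j := by
  choose! a haA ha using hd
  have hmono : ∀ i ∈ Finset.Icc 1 S.q, ∀ j ∈ Finset.Icc 1 S.q, i < j → a i < a j :=
    fun i hi j hj hij => h.lt_of_near hi hj hij ((ha i hi).trans hT) ((ha j hj).trans hT)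
  have hinj : Set.InjOn a (Finset.Icc 1 S.q) := by
    intro x hx y hy hxy
    rcases lt_trichotomy x y with h | h | h
    · have := hmono x hx y hy h; omega
    · exact h
    · have := hmono y hy x hx h; omega
  refine ⟨a, (Finset.eq_of_subset_of_card_le (Finset.image_subset_iff.2 haA) ?_).symm, ha, hmono⟩
  rw [Finset.card_image_of_injOn hinj]
  simpa using hcard

theorem exists_detects (h : Regular S n e C ξ w ρ r τ G κ M) :
    ∃ A ⊆ C, Detects S A ρ ∧ A.card ≤ S.q := by
  choose! a haC ha using h.near
  exact ⟨(Finset.Icc 1 S.q).image a, Finset.image_subset_iff.2 haC,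
    fun j hj => ⟨a j, Finset.mem_image_of_mem a hj, ha j hj⟩,
    Finset.card_image_le.trans (by simp)⟩

/-- A set that detects every change point only roughly can be improved. -/
theorem exists_RSS_lt (h : Regular S n e C ξ w ρ r τ G κ M) {A : Finset ℕ} (hAC : A ⊆ C)
    (hd : Detects S A τ) (hcard : A.card ≤ S.q) (hr : ¬ Detects S A r) :
    ∃ B ⊆ C, Detects S B τ ∧ B.card ≤ S.q ∧ RSS n (obs S e) B < RSS n (obs S e) A := by
  obtain ⟨a, hA, ha, -⟩ := h.exists_enumeration le_rfl hd hcard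
  have hτ := h.τ_pos
  have hτG := h.τ_le_G
  have hρr := h.ρ_le
  have hρ := h.ρ_nonneg
  have hrτ := h.r_le_τ
  simp only [Detects, not_forall, not_exists, not_and, not_le] at hr
  obtain ⟨j, hj, hfar⟩ := hr
  obtain ⟨hj1, hjq⟩ := Finset.mem_Icc.1 hj
  obtain ⟨p, rfl⟩ : ∃ p, j = p + 1 := ⟨j - 1, by omega⟩
  have haA : ∀ i ∈ Finset.Icc 1 S.q, a i ∈ A := fun i hi => by
    rw [hA]; exact Finset.mem_image_of_mem a hi
  obtain ⟨c, hcC, hc⟩ := h.near (p + 1) hj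
  have har := hfar _ (haA _ hj)
  have haj := ha _ hj
  set x := a (p + 1) with hx
  set A₀ := A.erase x with hA₀
  have hA₀C : A₀ ⊆ C := (Finset.erase_subset _ _).trans hAC
  have hA₀n := hA₀C.trans h.subset
  have hA₀far : ∀ y ∈ A₀, G / 2 ≤ S.d (p + 1) ^ 2 * |(y : ℝ) - S.k (p + 1)| := by
    intro y hy
    obtain ⟨hyx, hyA⟩ := Finset.mem_erase.1 hy
    rw [hA] at hyA
    obtain ⟨i, hi, rfl⟩ := Finset.mem_image.1 hyA
    exact h.valid.far_of_near h.strength (by linarith) hi hj (fun heq => hyx (by rw [heq])) (ha i hi)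
  have hA₀near : ∀ i ∈ Finset.Icc 1 S.q, i ≠ p + 1 →
      ∃ y ∈ A₀, S.d i ^ 2 * |(y : ℝ) - S.k i| ≤ τ := by
    intro i hi hne
    refine ⟨a i, Finset.mem_erase.2 ⟨fun heq => ?_, haA i hi⟩, ha i hi⟩
    have := h.valid.far_of_near h.strength (by linarith) hi hj hne (ha i hi)
    rw [heq] at this
    linarith
  have hend : ∀ y : ℕ, y = 0 ∨ y = n → G / 2 ≤ S.d (p + 1) ^ 2 * |(y : ℝ) - S.k (p + 1)| :=
    fun y hy => by linarith [h.valid.far_of_end h.strength hj hy]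
  have hcA₀ : c ∉ A₀ := fun hh => by linarith [hA₀far c hh]
  obtain ⟨h0, h1⟩ := Finset.mem_Ioo.1 (h.subset hcC)
  obtain ⟨u, v, hs, huc, hcv⟩ := exists_isSegment hcA₀ h0 h1
  have hu : G / 2 ≤ S.d (p + 1) ^ 2 * |(u : ℝ) - S.k (p + 1)| := by
    rcases Finset.mem_insert.1 hs.left with hu | hu
    · exact hend u (Or.inl hu)
    · exact hA₀far u hu
  have hv : G / 2 ≤ S.d (p + 1) ^ 2 * |(v : ℝ) - S.k (p + 1)| := by
    rcases hs.right with hv | hv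
    · exact hA₀far v hv
    · exact hend v (Or.inr hv)
  -- The segment was found around `c`; its ends are far from the change point, so it also contains
  -- the change point and the old cut point `x`.
  have hside : ∀ y : ℕ, S.d (p + 1) ^ 2 * |(y : ℝ) - S.k (p + 1)| ≤ τ → u < y ∧ y < v := by
    intro y hy
    have hc' : S.d (p + 1) ^ 2 * |(c : ℝ) - S.k (p + 1)| < G / 2 := by linarith
    have hy' : S.d (p + 1) ^ 2 * |(y : ℝ) - S.k (p + 1)| < G / 2 := by linarith
    constructor
    · exact_mod_cast lt_of_lt_of_near (sq_nonneg _) hu hc' hy'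
        (show (u : ℝ) < c by exact_mod_cast huc)
    · by_contra hvy
      have hne : v ≠ y := fun heq => by rw [heq] at hv; linarith
      have hvy' : (v : ℝ) < y := by exact_mod_cast lt_of_le_of_ne (not_lt.1 hvy) hne
      have : (v : ℝ) < c := lt_of_lt_of_near (sq_nonneg _) hv hy' hc' hvy'
      have : v < c := by exact_mod_cast this
      omega
  obtain ⟨huk, hkv⟩ := hside (S.k (p + 1)) (by simpa using hτ.le)
  obtain ⟨hux, hxv⟩ := hside x haj
  have hI := h.valid.isolates h.strength hτ.le (by linarith) (by omega) hs hA₀near huk hkv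
  have hlt := h.segSq_swap_lt hI hux hxv huc hcv hc haj har hu hv
  have hAx : insert x A₀ = A := Finset.insert_erase (haA _ hj)
  refine ⟨insert c A₀, Finset.insert_subset hcC hA₀C, ?_, ?_, ?_⟩
  · intro i hi
    by_cases hne : i = p + 1
    · rw [hne]
      exact ⟨c, Finset.mem_insert_self _ _, by linarith⟩
    · obtain ⟨y, hy, hy'⟩ := hA₀near i hi hne
      exact ⟨y, Finset.mem_insert_of_mem hy, hy'⟩
  · rw [Finset.card_insert_of_notMem hcA₀, Finset.card_erase_of_mem (haA _ hj)]
    have : 0 < A.card := Finset.card_pos.2 ⟨_, haA _ hj⟩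
    omega
  · rw [← hAx, RSS_eq_segSum, RSS_eq_segSum, segSum_insert hA₀n hs huc hcv,
      segSum_insert hA₀n hs hux hxv]
    linarith

theorem detects_of_isPruned (h : Regular S n e C ξ w ρ r τ G κ M) {A : Finset ℕ}
    (hA : IsPruned n ξ (obs S e) C A) : Detects S A r ∧ A.card = S.q := by
  classical
  obtain ⟨hadm, hmin, hSC⟩ := hA
  have hτ := h.τ_pos
  have hrτ := h.r_le_τ
  have hr := h.r_pos
  have hρr := h.ρ_le
  have hρ := h.ρ_nonneg
  have hge : ∀ B ∈ admissible n ξ (obs S e) C, S.q ≤ B.card := fun B hB =>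
    h.card_ge_of_detects (h.detects_of_mem_admissible hB)
  obtain ⟨B₀, hB₀C, hB₀d, hB₀card⟩ := h.exists_detects
  have hB₀adm := h.mem_admissible hB₀C (hB₀d.mono subset_rfl (by linarith))
  have hcard : A.card = S.q := le_antisymm ((hmin B₀ hB₀adm).trans hB₀card) (hge A hadm)
  refine ⟨?_, hcard⟩
  by_contra hnot
  have hqpos : C.Nonempty := by
    simp only [Detects, not_forall] at hnot
    obtain ⟨j, hj, -⟩ := hnot
    obtain ⟨c, hc, -⟩ := h.near j hj
    exact ⟨c, hc⟩
  -- One exchange in `A` need not produce a member of (C1), since other points may still be only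
  -- roughly right. A minimiser of RSS over all roughly correct sets is right to within `r`
  -- everywhere, hence it is in (C1).
  set F := C.powerset.filter fun B => Detects S B τ ∧ B.card ≤ S.q with hF
  have hB₀F : B₀ ∈ F := Finset.mem_filter.2
    ⟨Finset.mem_powerset.2 hB₀C, hB₀d.mono subset_rfl (by linarith), hB₀card⟩
  obtain ⟨B, hBF, hBmin⟩ := Finset.exists_min_image F (RSS n (obs S e)) ⟨B₀, hB₀F⟩
  obtain ⟨hBC, hBd, hBcard⟩ := Finset.mem_filter.1 hBF
  rw [Finset.mem_powerset] at hBC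
  have hBr : Detects S B r := by
    by_contra hBr
    obtain ⟨B', hB'C, hB'd, hB'card, hlt⟩ := h.exists_RSS_lt hBC hBd hBcard hBr
    exact absurd (hBmin B' (Finset.mem_filter.2 ⟨Finset.mem_powerset.2 hB'C, hB'd, hB'card⟩))
      (not_le.2 hlt)
  have hBadm := h.mem_admissible hBC hBr
  have hBq : B.card = A.card := by rw [hcard]; exact le_antisymm hBcard (hge B hBadm)
  have hle := hSC B hBadm hBq
  obtain ⟨B', hB'C, hB'd, hB'card, hlt⟩ := h.exists_RSS_lt hadm.1 (h.detects_of_mem_admissible hadm)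
    hcard.le hnot
  have hBlt : RSS n (obs S e) B < RSS n (obs S e) A := lt_of_le_of_lt
    (hBmin B' (Finset.mem_filter.2 ⟨Finset.mem_powerset.2 hB'C, hB'd, hB'card⟩)) hlt
  have hn : (0 : ℝ) < n := by exact_mod_cast h.n_pos
  have hlog : Real.log (RSS n (obs S e) B / n) < Real.log (RSS n (obs S e) A / n) :=
    Real.log_lt_log (div_pos (h.RSS_pos hqpos hBC) hn) (by gcongr)
  unfold SC at hle
  rw [hBq] at hle
  nlinarith

/-- The deterministic core of the consistency theorem. -/
theorem consistent (h : Regular S n e C ξ w ρ r τ G κ M) {A : Finset ℕ}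
    (hA : IsPruned n ξ (obs S e) C A) :
    A.card = S.q ∧ ∀ j ∈ Finset.Icc 1 S.q, S.d j ^ 2 * |(estimate A j : ℝ) - S.k j| ≤ r := by
  obtain ⟨hd, hcard⟩ := h.detects_of_isPruned hA
  refine ⟨hcard, fun j hj => ?_⟩
  obtain ⟨a, rfl, ha, hmono⟩ := h.exists_enumeration (by linarith [h.r_le_τ, h.r_pos]) hd hcard.le
  rw [estimate_image hmono hj]
  exact ha j hj

end Regular

/-! ### Laws of large numbers -/

/-- The mean ergodic theorem for square-integrable observables. -/
theorem tendstoInMeasure_birkhoffAverage {α : Type*} [MeasurableSpace α] {μ : Measure α}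
    [IsProbabilityMeasure μ] {T : α → α} (hT : Ergodic T μ) {g : α → ℝ} (hg : MemLp g 2 μ) :
    TendstoInMeasure μ (fun n => birkhoffAverage ℝ T g n) atTop (fun _ => ∫ x, g x ∂μ) := by
  have hmp := hT.toMeasurePreserving
  set U : Lp ℝ 2 μ →L[ℝ] Lp ℝ 2 μ :=
    (Lp.compMeasurePreservingₗᵢ ℝ T hmp).toContinuousLinearMap with hU
  have hUapp : ∀ F : Lp ℝ 2 μ, U F = Lp.compMeasurePreserving T hmp F := fun _ => rfl
  -- Von Neumann's theorem for the Koopman isometry. The limit is invariant, hence constant by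
  -- ergodicity; comparing integrals, continuous on `L²` as inner products with 1, identifies the
  -- constant.
  have hlim := U.tendsto_birkhoffAverage_orthogonalProjection
    (LinearIsometry.norm_toContinuousLinearMap_le _) (hg.toLp g)
  set p := (U.eqLocus (1 : Lp ℝ 2 μ →L[ℝ] Lp ℝ 2 μ)).orthogonalProjectionOnto (hg.toLp g)
  have hfix : U (p : Lp ℝ 2 μ) = p := p.2
  have hiter : ∀ k, (U^[k]) (hg.toLp g) = (hg.comp_measurePreserving (hmp.iterate k)).toLp _ := by
    intro k
    have : (U : Lp ℝ 2 μ → Lp ℝ 2 μ) = Lp.compMeasurePreserving T hmp := rfl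
    rw [this, Lp.compMeasurePreserving_iterate]
    rfl
  have hA : ∀ n, (birkhoffAverage ℝ U _root_.id n (hg.toLp g) : Lp ℝ 2 μ) =ᵐ[μ]
      birkhoffAverage ℝ T g n := by
    intro n
    have hsum : ∀ n, (birkhoffSum U _root_.id n (hg.toLp g) : Lp ℝ 2 μ) =ᵐ[μ]
        birkhoffSum T g n := by
      intro n
      induction n with
      | zero =>
        simp only [birkhoffSum_zero]
        exact Lp.coeFn_zero _ _ _
      | succ n ih =>
        rw [birkhoffSum_succ]
        refine (Lp.coeFn_add _ _).trans ?_
        have h1 : ((_root_.id (U^[n] (hg.toLp g)) : Lp ℝ 2 μ) : α → ℝ) =ᵐ[μ] g ∘ T^[n] := by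
          rw [id, hiter]
          exact MemLp.coeFn_toLp _
        filter_upwards [ih, h1] with x hx hx1
        rw [Pi.add_apply, hx, hx1, birkhoffSum_succ]
        rfl
    refine (Lp.coeFn_smul _ _).trans ?_
    filter_upwards [hsum n] with x hx
    rw [Pi.smul_apply, hx]
    rfl
  obtain ⟨c, hc⟩ := hT.ae_eq_const_of_ae_eq_comp_ae (Lp.aestronglyMeasurable (p : Lp ℝ 2 μ))
    ((Lp.coeFn_compMeasurePreserving (p : Lp ℝ 2 μ) hmp).symm.trans (by rw [← hUapp, hfix]))
  have hmeas := tendstoInMeasure_of_tendsto_Lp hlim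
  have hint : ∀ n, n ≠ 0 → ∫ x, birkhoffAverage ℝ T g n x ∂μ = ∫ x, g x ∂μ := by
    intro n hn
    have hgi : ∀ k, Integrable (fun x => g (T^[k] x)) μ := fun k =>
      (hg.comp_measurePreserving (hmp.iterate k)).integrable (by norm_num)
    have hgi' : ∀ k, ∫ x, g (T^[k] x) ∂μ = ∫ x, g x ∂μ := fun k => by
      have h1 := (hmp.iterate k).map_eq
      conv_rhs => rw [← h1]
      rw [integral_map (hmp.iterate k).measurable.aemeasurable]
      rw [h1]
      exact hg.aestronglyMeasurable
    have hn' : (n : ℝ) ≠ 0 := by exact_mod_cast hn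
    simp only [birkhoffAverage, birkhoffSum, smul_eq_mul]
    rw [integral_const_mul, integral_finsetSum _ fun k _ => hgi k]
    simp [hgi', hn']
  have hci : c = ∫ x, g x ∂μ := by
    have h1 : Tendsto (fun n => ∫ x, (birkhoffAverage ℝ U _root_.id n (hg.toLp g) : Lp ℝ 2 μ) x ∂μ)
        atTop (𝓝 (∫ x, (p : Lp ℝ 2 μ) x ∂μ)) := by
      have h2 : Continuous fun F : Lp ℝ 2 μ => ∫ x, F x ∂μ := by
        have h3 : (fun F : Lp ℝ 2 μ => ∫ x, F x ∂μ) =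
            fun F => inner ℝ ((memLp_const (1 : ℝ)).toLp (fun _ : α => (1 : ℝ)) : Lp ℝ 2 μ) F := by
          funext F
          rw [L2.inner_def]
          refine integral_congr_ae ?_
          filter_upwards [MemLp.coeFn_toLp (memLp_const (μ := μ) (p := 2) (1 : ℝ))] with x hx
          rw [hx]
          simp
        rw [h3]
        fun_prop
      exact (h2.tendsto _).comp hlim
    have h4 : ∫ x, (p : Lp ℝ 2 μ) x ∂μ = c := by
      rw [integral_congr_ae hc]; simp
    rw [h4] at h1
    refine tendsto_nhds_unique h1 (tendsto_const_nhds.congr' ?_)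
    filter_upwards [eventually_ne_atTop 0] with n hn
    rw [integral_congr_ae (hA n), hint n hn]
  rw [← hci]
  exact hmeas.congr hA hc

section

variable {Ω : Type*} [MeasurableSpace Ω] {P : Measure Ω}

theorem exists_truncation {X : Ω → ℝ} (hX : MemLp X 2 P) {c : ℝ} (hc : c < ∫ x, X x ^ 2 ∂P) :
    ∃ N : ℕ, c < ∫ x, min (X x ^ 2) (N : ℝ) ∂P := by
  have hint : Integrable (fun x => X x ^ 2) P := hX.integrable_sq
  have h1 : Tendsto (fun N : ℕ => ∫ x, min (X x ^ 2) (N : ℝ) ∂P) atTop (𝓝 (∫ x, X x ^ 2 ∂P)) := by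
    refine tendsto_integral_of_dominated_convergence (fun x => X x ^ 2) (fun N => ?_) hint
      (fun N => ?_) ?_
    · exact hint.aestronglyMeasurable.inf aestronglyMeasurable_const
    · refine Eventually.of_forall fun x => ?_
      rw [Real.norm_of_nonneg (le_min (sq_nonneg _) (Nat.cast_nonneg _))]
      exact min_le_left _ _
    · refine Eventually.of_forall fun x => tendsto_const_nhds.congr' ?_
      obtain ⟨N, hN⟩ := exists_nat_ge (X x ^ 2)
      filter_upwards [eventually_ge_atTop N] with m hm
      exact (min_eq_left (hN.trans (by exact_mod_cast hm))).symm
  exact (h1.eventually (lt_mem_nhds hc)).exists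

variable [IsProbabilityMeasure P]

/-- The empirical second moments of ergodic errors are bounded away from zero. -/
theorem exists_sum_sq_ge {ε : ℕ → Ω → ℝ} (hm : ∀ t, Measurable (ε t))
    (herg : IsErgodicSequence P ε) (hL : ∀ t, 1 ≤ t → MemLp (ε t) 2 P) {c₀ : ℝ} (hc₀ : 0 < c₀)
    (hvar : ∀ t, 1 ≤ t → c₀ ≤ ∫ x, ε t x ^ 2 ∂P) :
    ∃ κ : ℝ, 0 < κ ∧
      Tendsto (fun n : ℕ => P.real {x | ¬ κ * n ≤ ∑ t ∈ Finset.Ioc 0 n, ε t x ^ 2}) atTop (𝓝 0) := by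
  rcases herg with hstat | hmean
  · set path : Ω → ℕ → ℝ := fun x i => ε (i + 1) x with hpath
    have hpm : Measurable path := measurable_pi_lambda _ fun i => hm (i + 1)
    set μ := P.map path with hμ
    have : IsProbabilityMeasure μ := Measure.isProbabilityMeasure_map hpm.aemeasurable
    have hv := hvar 1 le_rfl
    -- `ε²` is only integrable, while the ergodic theorem is available in `L²`. A truncation keeps
    -- more than half of `c₀`, which suffices for a lower bound.
    obtain ⟨N, hN⟩ := exists_truncation (hL 1 le_rfl) (c := c₀ / 2) (by linarith)
    set g : (ℕ → ℝ) → ℝ := fun y => min (y 0 ^ 2) (N : ℝ) with hg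
    have hgm : Measurable g := ((measurable_pi_apply 0).pow_const 2).min measurable_const
    have hgL : MemLp g 2 μ := by
      refine MemLp.of_bound hgm.aestronglyMeasurable (N : ℝ) (Eventually.of_forall fun y => ?_)
      rw [Real.norm_of_nonneg (le_min (sq_nonneg _) (Nat.cast_nonneg _))]
      exact min_le_right _ _
    have hgint : ∫ y, g y ∂μ = ∫ x, min (ε 1 x ^ 2) (N : ℝ) ∂P :=
      integral_map hpm.aemeasurable hgm.aestronglyMeasurable
    have hconv := tendstoInMeasure_birkhoffAverage hstat hgL
    rw [tendstoInMeasure_iff_measureReal_dist] at hconv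
    refine ⟨c₀ / 4, by positivity, squeeze_zero' (Eventually.of_forall fun n => measureReal_nonneg)
      ?_ (hconv (c₀ / 4) (by positivity))⟩
    filter_upwards [eventually_gt_atTop 0] with n hn
    have hn' : (0 : ℝ) < n := by exact_mod_cast hn
    refine le_trans (measureReal_mono fun x hx => ?_) (ENNReal.toReal_mono (measure_ne_top _ _)
      (Measure.le_map_apply hpm.aemeasurable _))
    simp only [Set.mem_ofPred_eq, not_le] at hx
    have hiter : ∀ (i : ℕ) (y : ℕ → ℝ),
        (fun (z : ℕ → ℝ) (j : ℕ) => z (j + 1))^[i] y = fun j => y (j + i) := by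
      intro i
      induction i with
      | zero => intro y; rfl
      | succ i ih =>
        intro y
        rw [Function.iterate_succ_apply, ih]
        funext j
        rw [add_assoc]
    have havg : birkhoffAverage ℝ (fun (z : ℕ → ℝ) (j : ℕ) => z (j + 1)) g n (path x) ≤ c₀ / 4 := by
      simp only [birkhoffAverage, birkhoffSum, smul_eq_mul, hiter]
      rw [inv_mul_le_iff₀ hn', mul_comm]
      refine le_trans ?_ hx.le
      -- Coordinate `i` of the path is `ε (i + 1)`, so the Birkhoff sum over `i < n` runs over the
      -- times `1, ..., n`.
      have hIoc : Finset.Ioc 0 n = Finset.Ico (0 + 1) (n + 1) := by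
        ext t
        rw [Finset.mem_Ioc, Finset.mem_Ico]
        omega
      rw [hIoc, ← Finset.sum_Ico_add' (fun t => ε t x ^ 2) 0 n 1, Finset.range_eq_Ico]
      refine Finset.sum_le_sum fun i _ => ?_
      simp only [hg, hpath, zero_add]
      exact min_le_left _ _
    change c₀ / 4 ≤ dist (birkhoffAverage ℝ (fun (z : ℕ → ℝ) (j : ℕ) => z (j + 1)) g n (path x))
      (∫ y, g y ∂μ)
    rw [hgint]
    rw [dist_comm, Real.dist_eq]
    exact le_trans (by linarith) (le_abs_self _)
  · have h1 := hmean 1 (fun y => y 0 ^ 2) ((measurable_pi_apply 0).pow_const 2)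
      ⟨1, fun y => by
        have h2 : |y 0| ≤ ‖y‖ := norm_le_pi_norm y 0
        rw [abs_of_nonneg (sq_nonneg _), ← sq_abs]
        nlinarith [abs_nonneg (y 0)]⟩
    rw [tendstoInMeasure_iff_measureReal_dist] at h1
    refine ⟨c₀ / 2, by positivity, squeeze_zero' (Eventually.of_forall fun n => measureReal_nonneg)
      ?_ (h1 (c₀ / 2) (by positivity))⟩
    filter_upwards [eventually_gt_atTop 0] with n hn
    have hn' : (0 : ℝ) < n := by exact_mod_cast hn
    refine measureReal_mono fun x hx => ?_
    simp only [Set.mem_ofPred_eq, not_le] at hx ⊢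
    have h3 : ∑ t ∈ Finset.Icc 1 n, (ε t x ^ 2 - ∫ y, ε t y ^ 2 ∂P) ≤ -(c₀ / 2) * n := by
      rw [Finset.sum_sub_distrib]
      have h4 : (n : ℝ) * c₀ ≤ ∑ t ∈ Finset.Icc 1 n, ∫ y, ε t y ^ 2 ∂P := by
        have := Finset.card_nsmul_le_sum (Finset.Icc 1 n) (fun t => ∫ y, ε t y ^ 2 ∂P) c₀
          fun t ht => hvar t (Finset.mem_Icc.1 ht).1
        simpa using this
      have h5 : Finset.Ioc 0 n = Finset.Icc 1 n := rfl
      rw [h5] at hx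
      linarith
    rw [dist_comm, Real.dist_eq]
    refine le_trans ?_ (le_abs_self _)
    simp only [Fin.val_zero, add_zero]
    rw [zero_sub, le_neg, div_le_iff₀ hn']
    exact h3

/-- The empirical second moments are bounded with high probability. -/
theorem measureReal_sum_sq_gt_le {ε : ℕ → Ω → ℝ} (hL : ∀ t, 1 ≤ t → MemLp (ε t) 2 P) {c₁ : ℝ}
    (hvar : ∀ t, 1 ≤ t → ∫ x, ε t x ^ 2 ∂P ≤ c₁) {M : ℝ} (hM : 0 < M) {n : ℕ} (hn : 0 < n) :
    P.real {x | ¬ ∑ t ∈ Finset.Ioc 0 n, ε t x ^ 2 ≤ M * n} ≤ c₁ / M := by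
  have hn' : (0 : ℝ) < n := by exact_mod_cast hn
  have hi : ∀ t ∈ Finset.Ioc 0 n, Integrable (fun x => ε t x ^ 2) P := fun t ht =>
    (hL t (Finset.mem_Ioc.1 ht).1).integrable_sq
  have h1 := mul_meas_ge_le_integral_of_nonneg (μ := P)
    (f := fun x => ∑ t ∈ Finset.Ioc 0 n, ε t x ^ 2)
    (Eventually.of_forall fun x => Finset.sum_nonneg fun t _ => sq_nonneg _)
    (integrable_finsetSum _ hi) (M * n)
  rw [integral_finsetSum _ hi] at h1
  have h2 : ∑ t ∈ Finset.Ioc 0 n, ∫ x, ε t x ^ 2 ∂P ≤ n * c₁ := by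
    have := Finset.sum_le_card_nsmul (Finset.Ioc 0 n) (fun t => ∫ x, ε t x ^ 2 ∂P) c₁
      fun t ht => hvar t (Finset.mem_Ioc.1 ht).1
    simpa using this
  have h3 : P.real {x | ¬ ∑ t ∈ Finset.Ioc 0 n, ε t x ^ 2 ≤ M * n} ≤
      P.real {x | M * n ≤ ∑ t ∈ Finset.Ioc 0 n, ε t x ^ 2} :=
    measureReal_mono fun x hx => (not_le.1 hx).le
  rw [le_div_iff₀ hM]
  refine le_of_mul_le_mul_left ?_ hn'
  nlinarith [mul_le_mul_of_nonneg_left h3 (by positivity : 0 ≤ M * n)]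

end

/-! ### From the events to regular samples -/

theorem noise_of_mem_eventM11 {Ω : Type*} {ε : ℕ → Ω → ℝ} {n : ℕ} {w : ℝ} {x : Ω}
    (h : x ∈ eventM11 ε n w) (s t : ℕ) (hst : s < t) (ht : t ≤ n) :
    ((t : ℝ) - s) * segMean (fun i => ε i x) s t ^ 2 ≤ w ^ 2 := by
  have hlen : (0 : ℝ) < (t : ℝ) - s := sub_pos.2 (by exact_mod_cast hst)
  have h1 := pow_le_pow_left₀ (by positivity) (h s t hst ht) 2
  refine le_trans (le_of_eq ?_) h1
  rw [mul_pow, div_pow, Real.sq_sqrt hlen.le, sq_abs, segMean]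
  field_simp

theorem sum_far_of_le {d l r w E : ℝ} (hr : 0 < r) (hl : 0 < l) (hd : d ≠ 0) (hw : 16 * w ≤ √r)
    (h : √(r / d ^ 2) / l * |E| ≤ w) : 16 * |E| ≤ |d| * l := by
  have hsr : 0 < √r := Real.sqrt_pos.2 hr
  have hd' : 0 < |d| := abs_pos.2 hd
  rw [Real.sqrt_div hr.le, Real.sqrt_sq_eq_abs] at h
  have h1 : √r * |E| ≤ w * (|d| * l) := by
    have : √r / |d| / l * |E| = √r * |E| / (|d| * l) := by field_simp
    rwa [this, div_le_iff₀ (by positivity)] at h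
  refine le_of_mul_le_mul_left ?_ hsr
  nlinarith [mul_pos hd' hl]

theorem sum_near_of_le {d r w E : ℝ} (hr : 0 < r) (hd : d ≠ 0) (hw : 16 * w ≤ √r)
    (h : 1 / √(r / d ^ 2) * |E| ≤ w) : 16 * (|d| * |E|) ≤ r := by
  have hsr : 0 < √r := Real.sqrt_pos.2 hr
  have hd' : 0 < |d| := abs_pos.2 hd
  rw [Real.sqrt_div hr.le, Real.sqrt_sq_eq_abs] at h
  have h1 : |d| * |E| ≤ w * √r := by
    have : 1 / (√r / |d|) * |E| = |d| * |E| / √r := by field_simp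
    rwa [this, div_le_iff₀ hsr] at h
  nlinarith [Real.mul_self_sqrt hr.le]

theorem Signal.IsValid.sum_gap_le {S : Signal} {n : ℕ} (h : S.IsValid n) :
    ∑ j ∈ Finset.Icc 1 S.q, S.gap j ≤ n := by
  have key : ∀ m ≤ S.q, ∑ j ∈ Finset.Icc 1 m, S.gap j ≤ S.k m := by
    intro m
    induction m with
    | zero => simp
    | succ m ih =>
      intro hm
      rw [Finset.sum_Icc_succ_top (by omega)]
      have h1 := h.gap_add_le (i := m) (j := m + 1) (by omega) (by omega)
      have h2 := ih (by omega)
      omega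
  have h1 := key S.q le_rfl
  have h2 := h.k_lt S.q le_rfl
  rw [h.k_last] at h2
  omega

theorem Signal.IsValid.gap_pos {S : Signal} {n : ℕ} (h : S.IsValid n) {j : ℕ}
    (hj : j ∈ Finset.Icc 1 S.q) : 0 < S.gap j := by
  rw [Finset.mem_Icc] at hj
  have h1 := h.k_lt (j - 1) (by omega)
  have h2 := h.k_lt j (by omega)
  rw [Nat.sub_add_cancel hj.1] at h1
  unfold gap
  omega

/-- Bounded jumps force long gaps, and the gaps sum to at most `n`. With `G` a multiple of `ξ`, this
bounds `q w²` and `q τ` by multiples of `n`. -/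
theorem Signal.IsValid.q_mul_le {S : Signal} {n : ℕ} (h : S.IsValid n) {B G : ℝ}
    (hB : ∀ j ∈ Finset.Icc 1 S.q, |S.d j| ≤ B)
    (hG : ∀ j ∈ Finset.Icc 1 S.q, G ≤ S.d j ^ 2 * (S.gap j : ℝ)) :
    (S.q : ℝ) * G ≤ B ^ 2 * n := by
  have h1 : ∀ j ∈ Finset.Icc 1 S.q, G ≤ B ^ 2 * (S.gap j : ℝ) := fun j hj =>
    (hG j hj).trans (mul_le_mul_of_nonneg_right
      (sq_le_sq' (by linarith [neg_abs_le (S.d j), hB j hj]) ((le_abs_self _).trans (hB j hj)))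
      (Nat.cast_nonneg _))
  have h2 := Finset.sum_le_sum h1
  rw [Finset.sum_const, Nat.card_Icc, nsmul_eq_mul, Nat.add_sub_cancel, ← Finset.mul_sum] at h2
  have h3 : ∑ j ∈ Finset.Icc 1 S.q, (S.gap j : ℝ) ≤ n := by exact_mod_cast h.sum_gap_le
  exact h2.trans (mul_le_mul_of_nonneg_left h3 (sq_nonneg B))

/-- The conditions on the rates at a fixed sample size. -/
structure RateBounds (S : Signal) (n : ℕ) (w w₁ w₂ ξ ρ r κ M A : ℝ) : Prop where
  valid : S.IsValid n
  n_pos : 0 < n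
  one_le_r : 1 ≤ r
  ρ_pos : 0 < ρ
  ξ_pos : 0 < ξ
  ρ_le_r : 16 * ρ ≤ r
  r_le_ξ : r ≤ ξ
  r_le_κξ : 36 * r ≤ κ * ξ
  w_le_ξ : w ^ 2 ≤ ξ
  w_le_κξ : 16 * w ^ 2 ≤ κ * ξ
  max_le : 16 * max w₁ w₂ ≤ √r
  ρ_le_w : ρ ≤ A * w ^ 2
  strength : ∀ j ∈ Finset.Icc 1 S.q,
    10000 * ((100 * (2 * M + 18) + 1) * ξ) ≤ S.d j ^ 2 * (S.gap j : ℝ)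
  q_w : S.q * w ^ 2 ≤ κ / 4 * n
  q_ξ : S.q * ((100 * (2 * M + 18) + 1) * ξ) ≤ n

theorem RateBounds.regular {Ω : Type*} {ε : ℕ → Ω → ℝ} {S : Signal} {C : Ω → Finset ℕ} {n : ℕ}
    {w w₁ w₂ ξ ρ r κ M A : ℝ} (h : RateBounds S n w w₁ w₂ ξ ρ r κ M A) (hκ : 0 < κ) (hM : 0 < M)
    (hA : 0 < A) {x : Ω} (hC : C x ⊆ Finset.Ioo 0 n)
    (hx : x ∈ eventM ε S C n w w₁ w₂ ρ r r) (hlow : κ * n ≤ ∑ t ∈ Finset.Ioc 0 n, ε t x ^ 2)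
    (hupp : ∑ t ∈ Finset.Ioc 0 n, ε t x ^ 2 ≤ M * n)
    (hc₁ : w ^ 2 * (C x).card ≤ κ / 8 * n) (hc₂ : w ^ 2 * (C x).card ≤ 1 / (2 * A) * n) :
    Regular S n (fun t => ε t x) (C x) ξ w ρ r ((100 * (2 * M + 18) + 1) * ξ)
      (10000 * ((100 * (2 * M + 18) + 1) * ξ)) κ M := by
  obtain ⟨⟨⟨h11, h12⟩, h13⟩, h2⟩ := hx
  have hr : 0 < r := lt_of_lt_of_le one_pos h.one_le_r
  have hξ := h.ξ_pos
  have hMξ : 0 < M * ξ := mul_pos hM hξ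
  have hcard : (C x).Nonempty → (1 : ℝ) ≤ (C x).card := fun hne => by
    exact_mod_cast Finset.card_pos.2 hne
  refine
    { valid := h.valid, n_pos := h.n_pos, subset := hC, κ_pos := hκ, M_pos := hM
      strength := h.strength, noise := noise_of_mem_eventM11 h11, sum_sq_ge := hlow
      sum_sq_le := hupp, near := h2, ρ_nonneg := h.ρ_pos.le, ρ_le := h.ρ_le_r, r_pos := hr
      τ_le_G := le_rfl, card_w := ?_, card_ρ := ?_, penalty_r := ?_, τ_pos := by positivity
      r_le_τ := ?_, w_le_τ := ?_, penalty_τ := by nlinarith, τ_le_n := ?_, sum_far := ?_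
      sum_near := ?_ }
  -- The budget `κ / 2` is spent as `κ / 8` on the candidates, `κ / 4` on the change points and `κ /
  -- 8` on the extra segment. The last uses `w² ≤ w² |C|`, valid as `C` is nonempty; no separate
  -- bound of `w²` by `n` is needed.
  · intro hne
    nlinarith [h.q_w, mul_le_mul_of_nonneg_right (hcard hne) (sq_nonneg w)]
  · intro hne
    have h3 : ((C x).card : ℝ) * ρ ≤ 1 / 2 * n := by
      calc ((C x).card : ℝ) * ρ ≤ (C x).card * (A * w ^ 2) := by gcongr; exact h.ρ_le_w
        _ = A * (w ^ 2 * (C x).card) := by ring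
        _ ≤ A * (1 / (2 * A) * n) := by gcongr
        _ = 1 / 2 * n := by field_simp
    nlinarith [mul_le_mul_of_nonneg_right (hcard hne) h.ρ_pos.le]
  · linarith [h.r_le_κξ, h.w_le_κξ]
  · nlinarith [h.r_le_ξ]
  · nlinarith [h.w_le_ξ]
  · intro hq
    have h3 : (1 : ℝ) ≤ S.q := by exact_mod_cast hq
    have h4 : 0 < (100 * (2 * M + 18) + 1) * ξ := by positivity
    nlinarith [h.q_ξ]
  · intro j hj l hl
    have hd := h.valid.d_ne_zero j hj
    have hd2 := h.valid.sq_pos hj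
    have hl0 : (0 : ℝ) < l := pos_of_mul_pos_right (hr.trans_le hl) hd2.le
    have hl' : r / S.d j ^ 2 ≤ l := (div_le_iff₀ hd2).2 (by linarith)
    have hw : 16 * w₁ ≤ √r := by linarith [h.max_le, le_max_left w₁ w₂]
    exact ⟨fun hlk => sum_far_of_le hr hl0 hd hw ((h12 j hj).1 l hl' hlk),
      fun hlk => sum_far_of_le hr hl0 hd hw ((h12 j hj).2 l hl' hlk)⟩
  · intro j hj l hl
    have hd := h.valid.d_ne_zero j hj
    have hd2 := h.valid.sq_pos hj
    rcases Nat.eq_zero_or_pos l with rfl | hl0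
    · simpa using hr.le
    have hl' : (l : ℝ) ≤ r / S.d j ^ 2 := (le_div_iff₀ hd2).2 (by linarith)
    have hw : 16 * w₂ ≤ √r := by linarith [h.max_le, le_max_right w₁ w₂]
    exact ⟨sum_near_of_le hr hd hw (h13 j hj l hl0 hl').1,
      sum_near_of_le hr hd hw (h13 j hj l hl0 hl').2⟩

/-! ### Rates -/

theorem eventually_le_strength {S : ℕ → Signal} (hS : SignalAssumption S) {ξ : ℕ → ℝ}
    (hξ : Tendsto (fun n => ENNReal.ofReal (ξ n) / (S n).strength) atTop (𝓝 0)) {K : ℝ}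
    (hK : 0 < K) :
    ∀ᶠ n in atTop, ∀ j ∈ Finset.Icc 1 (S n).q,
      K * ξ n ≤ (S n).d j ^ 2 * ((S n).gap j : ℝ) := by
  have hK' : 0 < 1 / K := by positivity
  filter_upwards [hξ.eventually (gt_mem_nhds (ENNReal.ofReal_pos.2 hK')),
    eventually_ge_atTop 1] with n hn hn1 j hj
  have hv := hS.valid n hn1
  have hpos : 0 < (S n).d j ^ 2 * ((S n).gap j : ℝ) :=
    mul_pos (hv.sq_pos hj) (by exact_mod_cast hv.gap_pos hj)
  have h1 : (S n).strength ≤ ENNReal.ofReal ((S n).d j ^ 2 * ((S n).gap j : ℝ)) :=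
    iInf₂_le j hj
  have h2 := (ENNReal.div_le_div_left h1 (ENNReal.ofReal (ξ n))).trans hn.le
  rw [← ENNReal.ofReal_div_of_pos hpos, ENNReal.ofReal_le_ofReal_iff hK'.le,
    div_le_div_iff₀ hpos hK] at h2
  linarith

/-- The precision that is shown to be attained: a rate below `ρ ν` that is of smaller order than
the penalty. -/
def precision (ρ ν ξ : ℝ) : ℝ := min (ρ * ν) (max 1 √(ρ * ξ))

/-- This yields `ρ = o(r)`: either `r = ρν` with `ν → ∞`, or `r` is at least the geometric mean of
`ρ` and the larger order `ξ`. -/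
theorem le_mul_precision {ρ ν ξ η : ℝ} (hρ : 0 < ρ) (hη : 0 < η) (hν : 1 ≤ η * ν)
    (hρξ : ρ ≤ η ^ 2 * ξ) : ρ ≤ η * precision ρ ν ξ := by
  unfold precision
  rcases min_choice (ρ * ν) (max 1 √(ρ * ξ)) with h | h
  · rw [h]; nlinarith
  · rw [h]
    have h1 : ρ / η ≤ √(ρ * ξ) := by
      refine Real.le_sqrt_of_sq_le ?_
      rw [div_pow, div_le_iff₀ (by positivity)]
      nlinarith
    have h2 : ρ / η ≤ max 1 √(ρ * ξ) := h1.trans (le_max_right _ _)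
    rw [div_le_iff₀ hη] at h2
    linarith

/-- This yields `r = o(ξ)` however fast `ν` grows. The lower cap 1 inside `precision`, which makes
`r` a legitimate scale, is harmless once `ξ → ∞`. -/
theorem precision_le_mul {ρ ν ξ η : ℝ} (hη : 0 < η) (hξ : 1 ≤ η * ξ)
    (hρξ : ρ ≤ η ^ 2 * ξ) : precision ρ ν ξ ≤ η * ξ := by
  refine (min_le_right _ _).trans (max_le hξ ?_)
  refine Real.sqrt_le_iff.2 ⟨by linarith, ?_⟩
  have : 0 < ξ := by
    by_contra! h
    nlinarith
  nlinarith

theorem eventually_rateBounds {S : ℕ → Signal} {w w₁ w₂ ξ ρ ν : ℕ → ℝ} (hS : SignalAssumption S)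
    (hw : (fun n : ℕ => √(Real.log n)) =O[atTop] w) (hξ : PenaltyAssumption S w ξ)
    (hρ₁ : (fun n => (max (w₁ n) (w₂ n)) ^ 2) =O[atTop] ρ)
    {A : ℝ} (hA : 0 < A) (hρ₂ : ∀ᶠ n in atTop, ρ n ≤ A * w n ^ 2)
    (hν : Tendsto ν atTop atTop) (hρν : ∀ᶠ n in atTop, 1 ≤ ρ n * ν n) {κ M : ℝ} (hκ : 0 < κ)
    (hM : 0 < M) :
    ∀ᶠ n in atTop, RateBounds (S n) n (w n) (w₁ n) (w₂ n) (ξ n) (ρ n)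
      (precision (ρ n) (ν n) (ξ n)) κ M A := by
  obtain ⟨B, hB⟩ := hS.jump_bounded
  obtain ⟨c, hc, hw⟩ := hw.exists_pos
  obtain ⟨c', hc', hρ₁⟩ := hρ₁.exists_pos
  have hwξ : ∀ η : ℝ, 0 < η → ∀ᶠ n in atTop, w n ^ 2 ≤ η * ξ n := fun η hη => by
    filter_upwards [hξ.lower.eventually (gt_mem_nhds hη)] with n hn
    exact ((div_lt_iff₀ (hξ.pos n)).1 hn).le
  have hρξ : ∀ η : ℝ, 0 < η → ∀ᶠ n in atTop, ρ n ≤ η * ξ n := fun η hη => by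
    filter_upwards [hρ₂, hwξ (η / A) (by positivity)] with n h1 h2
    calc ρ n ≤ A * w n ^ 2 := h1
      _ ≤ A * (η / A * ξ n) := by gcongr
      _ = η * ξ n := by field_simp
  -- `log n = O(w²)` and `w² = o(ξ)` force `ξ → ∞`.
  have hξ1 : ∀ η : ℝ, 0 < η → ∀ᶠ n in atTop, 1 ≤ η * ξ n := fun η hη => by
    have hlog : Tendsto (fun n : ℕ => Real.log n) atTop atTop :=
      Real.tendsto_log_atTop.comp tendsto_natCast_atTop_atTop
    filter_upwards [hw.bound, hwξ 1 one_pos, hlog.eventually_ge_atTop (c ^ 2 / η)] with n h1 h2 h3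
    have hlog0 : 0 ≤ Real.log n := (by positivity : 0 ≤ c ^ 2 / η).trans h3
    rw [Real.norm_of_nonneg (Real.sqrt_nonneg _), Real.norm_eq_abs] at h1
    have h4 := pow_le_pow_left₀ (Real.sqrt_nonneg _) h1 2
    rw [Real.sq_sqrt hlog0, mul_pow, sq_abs] at h4
    rw [div_le_iff₀ hη] at h3
    have h5 : c ^ 2 * 1 ≤ c ^ 2 * (η * ξ n) := by
      linarith [mul_le_mul_of_nonneg_right h4 hη.le,
        mul_le_mul_of_nonneg_left h2 (by positivity : 0 ≤ c ^ 2 * η)]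
    exact le_of_mul_le_mul_left h5 (by positivity)
  have hρpos : ∀ᶠ n in atTop, 0 < ρ n := by
    filter_upwards [hρν, hν.eventually_gt_atTop 0] with n h1 h2
    exact pos_of_mul_pos_left (one_pos.trans_le h1) h2.le
  have hρr : ∀ η : ℝ, 0 < η → ∀ᶠ n in atTop, ρ n ≤ η * precision (ρ n) (ν n) (ξ n) := fun η hη => by
    filter_upwards [hρpos, hν.eventually_ge_atTop (1 / η), hρξ (η ^ 2) (by positivity)]
      with n h1 h2 h3
    refine le_mul_precision h1 hη ?_ h3
    rw [div_le_iff₀ hη] at h2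
    linarith
  have hrξ : ∀ η : ℝ, 0 < η → ∀ᶠ n in atTop, precision (ρ n) (ν n) (ξ n) ≤ η * ξ n := fun η hη => by
    filter_upwards [hξ1 η hη, hρξ (η ^ 2) (by positivity)] with n h1 h2
    exact precision_le_mul hη h1 h2
  set L := 100 * (2 * M + 18) + 1 with hL
  have hLpos : 0 < L := by positivity
  have hstr : ∀ K : ℝ, 0 < K → ∀ᶠ n in atTop, (S n).q * (K * ξ n) ≤ B ^ 2 * n := fun K hK => by
    filter_upwards [eventually_le_strength hS hξ.upper hK, eventually_ge_atTop 1] with n h1 h2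
    exact (hS.valid n h2).q_mul_le (hB n h2) h1
  filter_upwards [eventually_ge_atTop 1, hρν, hρpos, hρr (1 / 16) (by norm_num), hrξ 1 one_pos,
    hrξ (κ / 36) (by positivity), hwξ 1 one_pos, hwξ (κ / 16) (by positivity), hρ₁.bound,
    hρr (1 / (256 * c')) (by positivity), hρ₂,
    eventually_le_strength hS hξ.upper (K := 10000 * L) (by positivity),
    -- `B² + 1` in place of `B²` can be cancelled even if `B = 0`.
    hstr ((B ^ 2 + 1) * (4 / κ)) (by positivity), hstr ((B ^ 2 + 1) * L) (by positivity)]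
    with n h1 h2 h3 h4 h5 h6 h7 h8 h9 h10 h11 h12 h13 h14
  have hq : (0 : ℝ) ≤ (S n).q := Nat.cast_nonneg _
  have hn : (0 : ℝ) ≤ n := Nat.cast_nonneg _
  have hBn : B ^ 2 * (n : ℝ) ≤ (B ^ 2 + 1) * n := by linarith
  refine
    { valid := hS.valid n h1, n_pos := h1, one_le_r := le_min h2 (le_max_left _ _), ρ_pos := h3
      ξ_pos := hξ.pos n, ρ_le_r := by linarith, r_le_ξ := by linarith, r_le_κξ := by linarith
      w_le_ξ := by linarith, w_le_κξ := by linarith, max_le := ?_, ρ_le_w := h11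
      strength := fun j hj => le_trans (le_of_eq (by ring)) (h12 j hj), q_w := ?_, q_ξ := ?_ }
  · refine Real.le_sqrt_of_sq_le ?_
    rw [Real.norm_of_nonneg (sq_nonneg _), Real.norm_of_nonneg h3.le] at h9
    have h15 : c' * ρ n ≤ c' * (1 / (256 * c') * precision (ρ n) (ν n) (ξ n)) := by gcongr
    have h16 : c' * (1 / (256 * c') * precision (ρ n) (ν n) (ξ n)) =
        precision (ρ n) (ν n) (ξ n) / 256 := by field_simp
    rw [mul_pow]
    linarith
  · refine le_of_mul_le_mul_left (?_ : (B ^ 2 + 1) * (4 / κ) * _ ≤ (B ^ 2 + 1) * (4 / κ) * _)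
      (by positivity)
    have h15 : (B ^ 2 + 1) * (4 / κ) * (κ / 4 * n) = (B ^ 2 + 1) * n := by field_simp
    rw [h15]
    refine le_trans ?_ (h13.trans hBn)
    have : (B ^ 2 + 1) * (4 / κ) * ((S n).q * w n ^ 2) =
        (S n).q * ((B ^ 2 + 1) * (4 / κ) * w n ^ 2) := by ring
    rw [this]
    gcongr
    linarith
  · refine le_of_mul_le_mul_left (?_ : (B ^ 2 + 1) * _ ≤ (B ^ 2 + 1) * _) (by positivity)
    linarith

/-! ### Probabilities of the events -/

variable {Ω : Type*} [MeasurableSpace Ω]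

theorem measurableSet_eventM11 {ε : ℕ → Ω → ℝ} (hm : ∀ t, Measurable (ε t)) (n : ℕ) (w : ℝ) :
    MeasurableSet (eventM11 ε n w) := by
  have h : eventM11 ε n w = ⋂ (s : ℕ) (e : ℕ) (_ : s < e) (_ : e ≤ n),
      {x | 1 / √((e : ℝ) - (s : ℝ)) * |∑ t ∈ Finset.Ioc s e, ε t x| ≤ w} := by
    ext x; simp [eventM11]
  rw [h]
  refine .iInter fun s => .iInter fun e => .iInter fun _ => .iInter fun _ => ?_
  exact measurableSet_le (by fun_prop) measurable_const

theorem measurableSet_eventM12 {ε : ℕ → Ω → ℝ} (hm : ∀ t, Measurable (ε t)) (S : Signal)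
    (a w : ℝ) : MeasurableSet (eventM12 ε S a w) := by
  have h : eventM12 ε S a w = ⋂ (j : ℕ) (_ : j ∈ Finset.Icc 1 S.q),
      (⋂ (l : ℕ) (_ : a / S.d j ^ 2 ≤ (l : ℝ)) (_ : l ≤ S.k j - S.k (j - 1)),
        {x | √(a / S.d j ^ 2) / (l : ℝ) * |∑ t ∈ Finset.Ioc (S.k j - l) (S.k j), ε t x| ≤ w}) ∩
      (⋂ (l : ℕ) (_ : a / S.d j ^ 2 ≤ (l : ℝ)) (_ : l ≤ S.k (j + 1) - S.k j),
        {x | √(a / S.d j ^ 2) / (l : ℝ) * |∑ t ∈ Finset.Ioc (S.k j) (S.k j + l), ε t x| ≤ w}) := by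
    ext x; simp [eventM12]
  rw [h]
  refine .iInter fun j => .iInter fun _ => .inter ?_ ?_ <;>
  · refine .iInter fun l => .iInter fun _ => .iInter fun _ => ?_
    exact measurableSet_le (by fun_prop) measurable_const

theorem measurableSet_eventM13 {ε : ℕ → Ω → ℝ} (hm : ∀ t, Measurable (ε t)) (S : Signal)
    (b w : ℝ) : MeasurableSet (eventM13 ε S b w) := by
  have h : eventM13 ε S b w = ⋂ (j : ℕ) (_ : j ∈ Finset.Icc 1 S.q) (l : ℕ) (_ : 1 ≤ l)
      (_ : (l : ℝ) ≤ b / S.d j ^ 2),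
      {x | 1 / √(b / S.d j ^ 2) * |∑ t ∈ Finset.Ioc (S.k j - l) (S.k j), ε t x| ≤ w} ∩
      {x | 1 / √(b / S.d j ^ 2) * |∑ t ∈ Finset.Ioc (S.k j) (S.k j + l), ε t x| ≤ w} := by
    ext x; simp [eventM13]
  rw [h]
  refine .iInter fun j => .iInter fun _ => .iInter fun l => .iInter fun _ => .iInter fun _ =>
    .inter ?_ ?_ <;>
  exact measurableSet_le (by fun_prop) measurable_const

variable {P : Measure Ω} [IsProbabilityMeasure P]

theorem tendsto_measureReal_compl {A : ℕ → Set Ω} (hA : ∀ n, MeasurableSet (A n))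
    (h : Tendsto (fun n => P.real (A n)) atTop (𝓝 1)) :
    Tendsto (fun n => P.real (A n)ᶜ) atTop (𝓝 0) := by
  simp only [fun n => probReal_compl_eq_one_sub (μ := P) (hA n)]
  simpa using h.const_sub 1

theorem measureReal_sub_compl_le (A B : Set Ω) : P.real A - P.real Bᶜ ≤ P.real (A ∩ B) := by
  have h1 : A ⊆ A ∩ B ∪ Bᶜ := fun x hx => by
    by_cases hB : x ∈ B
    · exact Or.inl ⟨hx, hB⟩
    · exact Or.inr hB
  have h2 := (measureReal_mono (μ := P) h1).trans (measureReal_union_le _ _)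
  linarith

/-- The second set need not be measurable. -/
theorem tendsto_measureReal_inter {A B : ℕ → Set Ω}
    (hA : Tendsto (fun n => P.real (A n)) atTop (𝓝 1))
    (hB : Tendsto (fun n => P.real (B n)ᶜ) atTop (𝓝 0)) :
    Tendsto (fun n => P.real (A n ∩ B n)) atTop (𝓝 1) := by
  have h1 : Tendsto (fun n => P.real (A n) - P.real (B n)ᶜ) atTop (𝓝 1) := by
    simpa using hA.sub hB
  exact tendsto_of_tendsto_of_tendsto_of_le_of_le h1 tendsto_const_nhds
    (fun n => measureReal_sub_compl_le _ _) fun n => measureReal_le_one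

/-- The candidate sets carry no measurability, so their event enters through its own probability;
complements are taken only of the measurable noise events. -/
theorem tendsto_measureReal_eventM {ε : ℕ → Ω → ℝ} {S : ℕ → Signal} {C : ℕ → Ω → Finset ℕ}
    {w w₁ w₂ ρ a b : ℕ → ℝ} (hε : ErrorAssumption P ε S w w₁ w₂)
    (hC : CandidateAssumption P S C w w₁ w₂ ρ) (ha : IsScale S a) (hb : IsScale S b) :
    Tendsto (fun n => P.real
      (eventM ε (S n) (C n) n (w n) (w₁ n) (w₂ n) (ρ n) (a n) (b n))) atTop (𝓝 1) := by
  have h1 := tendsto_measureReal_compl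
    (fun n => measurableSet_eventM11 hε.measurable n (w n)) hε.prob_M11
  have h2 := tendsto_measureReal_compl
    (fun n => (measurableSet_eventM12 hε.measurable (S n) (a n) (w₁ n)).inter
      (measurableSet_eventM13 hε.measurable (S n) (b n) (w₂ n))) (hε.prob_M12_M13 a b ha hb)
  refine (tendsto_measureReal_inter (tendsto_measureReal_inter hC.prob_M2 h1) h2).congr fun n => ?_
  congr 1
  ext x
  simp only [eventM, Set.mem_inter_iff]
  tauto

theorem isScale_of_le {S : ℕ → Signal} {r : ℕ → ℝ} (h : ∀ᶠ n in atTop, 1 ≤ r n ∧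
    ∀ j ∈ Finset.Icc 1 (S n).q, r n ≤ (S n).d j ^ 2 * ((S n).gap j : ℝ)) : IsScale S r := by
  filter_upwards [h] with n hn
  exact ⟨hn.1, le_iInf₂ fun j hj => ENNReal.ofReal_le_ofReal (hn.2 j hj)⟩

/-- The pruned set of candidates is consistent with the rate `ρ ν`. -/
theorem tendsto_measureReal_eventConsistent (ε : ℕ → Ω → ℝ) (S : ℕ → Signal)
    (C : ℕ → Ω → Finset ℕ) (w w₁ w₂ ξ ρ : ℕ → ℝ) (hS : SignalAssumption S)
    (hε : ErrorAssumption P ε S w w₁ w₂) (hξ : PenaltyAssumption S w ξ)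
    (hC : CandidateAssumption P S C w w₁ w₂ ρ) (K : ℕ → Ω → Finset ℕ)
    (hK : ∀ n x, IsPruned n (ξ n) (fun t => (S n).mean t + ε t x) (C n x) (K n x))
    (ν : ℕ → ℝ) (hν : Tendsto ν atTop atTop) (hρν : ∀ᶠ n in atTop, 1 ≤ ρ n * ν n) :
    Tendsto (fun n => P.real (eventConsistent (S n) (K n) (ρ n * ν n))) atTop (𝓝 1) := by
  obtain ⟨c₀, c₁, hc₀, hvar⟩ := hε.variance_bounds
  have hvar_eq : ∀ t, 1 ≤ t → variance (ε t) P = ∫ x, ε t x ^ 2 ∂P := fun t ht =>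
    variance_of_integral_eq_zero (hε.measurable t).aemeasurable (hε.centred t ht)
  have hlow : ∀ t, 1 ≤ t → c₀ ≤ ∫ x, ε t x ^ 2 ∂P := fun t ht => hvar_eq t ht ▸ (hvar t ht).1
  have hupp : ∀ t, 1 ≤ t → ∫ x, ε t x ^ 2 ∂P ≤ c₁ := fun t ht => hvar_eq t ht ▸ (hvar t ht).2
  have hc₁ : 0 < c₁ := hc₀.trans_le ((hlow 1 le_rfl).trans (hupp 1 le_rfl))
  obtain ⟨κ, hκ, hsum⟩ := exists_sum_sq_ge hε.measurable hε.ergodic hε.memLp hc₀ hlow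
  obtain ⟨A, hA, hρA⟩ := hC.precision_upper.exists_pos
  have hρA' : ∀ᶠ n in atTop, ρ n ≤ A * w n ^ 2 := by
    filter_upwards [hρA.bound] with n hn
    rw [Real.norm_of_nonneg (sq_nonneg (w n))] at hn
    exact (le_abs_self _).trans hn
  have hcard := tendstoInMeasure_iff_measureReal_dist.1 hC.card_small
  set η := min (κ / 8) (1 / (2 * A)) with hη
  have hηpos : 0 < η := lt_min (by positivity) (by positivity)
  have hrates := fun (M : ℝ) (hM : 0 < M) =>
    eventually_rateBounds hS hε.rate_lower hξ hC.precision_lower hA hρA' hν hρν hκ hM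
  set r : ℕ → ℝ := fun n => precision (ρ n) (ν n) (ξ n) with hr
  have hscale : IsScale S r := isScale_of_le <| by
    filter_upwards [hrates 1 one_pos] with n hn
    refine ⟨hn.one_le_r, fun j hj => ?_⟩
    have := hn.strength j hj
    linarith [hn.r_le_ξ, hn.ξ_pos]
  have hgood := tendsto_measureReal_inter (tendsto_measureReal_inter
    (tendsto_measureReal_eventM hε hC hscale hscale)
    (B := fun n => {x | κ * n ≤ ∑ t ∈ Finset.Ioc 0 n, ε t x ^ 2}) hsum)
    (B := fun n => {x | ¬ η ≤ dist (w n ^ 2 * ((C n x).card : ℝ) / (n : ℝ)) 0})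
    (by simpa [Set.compl_def] using hcard η hηpos)
  refine tendsto_order.2 ⟨fun y hy => ?_, fun y hy => Eventually.of_forall fun n =>
    measureReal_le_one.trans_lt hy⟩
  -- Markov's inequality then loses `(1 - y) / 2`; the other half of the deficit `1 - y` is left for
  -- the remaining events. The rate bounds are therefore kept available for every `M`.
  set M := 2 * c₁ / (1 - y) with hM
  have hy' : 0 < 1 - y := by linarith
  have hMpos : 0 < M := by positivity
  have hMeq : c₁ / M = (1 - y) / 2 := by rw [hM]; field_simp
  filter_upwards [hgood.eventually (lt_mem_nhds (show 1 - (1 - y) / 2 < 1 by linarith)),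
    hrates M hMpos] with n h1 h2
  have hn' : (0 : ℝ) < n := by exact_mod_cast h2.n_pos
  have h3 := measureReal_sum_sq_gt_le hε.memLp hupp hMpos h2.n_pos
  rw [hMeq] at h3
  refine lt_of_lt_of_le ?_ (measureReal_mono (μ := P)
    (s₁ := (eventM ε (S n) (C n) n (w n) (w₁ n) (w₂ n) (ρ n) (r n) (r n) ∩
        {x | κ * n ≤ ∑ t ∈ Finset.Ioc 0 n, ε t x ^ 2} ∩
        {x | ¬ η ≤ dist (w n ^ 2 * ((C n x).card : ℝ) / (n : ℝ)) 0}) ∩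
      {x | ∑ t ∈ Finset.Ioc 0 n, ε t x ^ 2 ≤ M * n}) (fun x hx => ?_))
  · refine lt_of_lt_of_le ?_ (measureReal_sub_compl_le _ _)
    have h4 : P.real {x | ∑ t ∈ Finset.Ioc 0 n, ε t x ^ 2 ≤ M * n}ᶜ ≤ (1 - y) / 2 := h3
    linarith
  · obtain ⟨⟨⟨hxM, hxlow⟩, hxcard⟩, hxupp⟩ := hx
    have hxη : w n ^ 2 * (C n x).card ≤ η * n := by
      have h5 : ¬ η ≤ dist (w n ^ 2 * ((C n x).card : ℝ) / (n : ℝ)) 0 := hxcard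
      rw [Real.dist_eq, sub_zero, abs_of_nonneg (by positivity), not_le, div_lt_iff₀ hn'] at h5
      exact h5.le
    have hreg := h2.regular hκ hMpos hA (hC.subset n x) hxM hxlow hxupp
      (hxη.trans (by gcongr; exact min_le_left _ _)) (hxη.trans (by gcongr; exact min_le_right _ _))
    obtain ⟨h6, h7⟩ := hreg.consistent (A := K n x) (hK n x)
    exact ⟨h6, fun j hj => (h7 j hj).trans (min_le_left _ _)⟩

end ChangePoint

end

theorem mainTheorem5 {Ω : Type*} [MeasurableSpace Ω] (P : MeasureTheory.Measure Ω)
    [MeasureTheory.IsProbabilityMeasure P]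
    (ε : ℕ → Ω → ℝ) (S : ℕ → ChangePoint.Signal) (C : ℕ → Ω → Finset ℕ)
    (w w₁ w₂ ξ ρ : ℕ → ℝ)
    (hS : ChangePoint.SignalAssumption S)
    (hε : ChangePoint.ErrorAssumption P ε S w w₁ w₂)
    (hsize : ChangePoint.SizeAssumption S w)
    (hξ : ChangePoint.PenaltyAssumption S w ξ)
    (hC : ChangePoint.CandidateAssumption P S C w w₁ w₂ ρ)
    (K : ℕ → Ω → Finset ℕ)
    (hK : ∀ n x, ChangePoint.IsPruned n (ξ n) (fun t => (S n).mean t + ε t x) (C n x) (K n x))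
    (ν : ℕ → ℝ) (hν : Tendsto ν atTop atTop) (hρν : ∀ᶠ n in atTop, 1 ≤ ρ n * ν n) :
    (∀ a b : ℕ → ℝ, ChangePoint.IsScale S a → ChangePoint.IsScale S b →
      Tendsto (fun n => P.real
        (ChangePoint.eventM ε (S n) (C n) n (w n) (w₁ n) (w₂ n) (ρ n) (a n) (b n)))
        atTop (𝓝 1) ∧
      ∃ r : ℕ → ℝ, Tendsto r atTop (𝓝 0) ∧
        ∀ n, P.real (ChangePoint.eventM ε (S n) (C n) n (w n) (w₁ n) (w₂ n) (ρ n) (a n) (b n))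
          + r n ≤ P.real (ChangePoint.eventConsistent (S n) (K n) (ρ n * ν n))) ∧
    Tendsto (fun n => P.real (ChangePoint.eventConsistent (S n) (K n) (ρ n * ν n)))
      atTop (𝓝 1) := by
  have hcons := ChangePoint.tendsto_measureReal_eventConsistent ε S C w w₁ w₂ ξ ρ hS hε hξ hC K hK
    ν hν hρν
  refine ⟨fun a b ha hb => ?_, hcons⟩
  have hM := ChangePoint.tendsto_measureReal_eventM hε hC ha hb
  -- The remainder is the difference of two probabilities that both tend to 1.
  refine ⟨hM, fun n => P.real (ChangePoint.eventConsistent (S n) (K n) (ρ n * ν n)) -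
    P.real (ChangePoint.eventM ε (S n) (C n) n (w n) (w₁ n) (w₂ n) (ρ n) (a n) (b n)), ?_,
    fun n => by linarith⟩
  simpa using hcons.sub hM
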